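/- Let $\mathcal Z$ be the algebra of real Zorn matrices $\begin{pmatrix} a & x\\ y & b\end{pmatrix}$ ($a,b\in\mathbb R$, $x,y\in\mathbb R^3$), with product $$\begin{pmatrix} a & x\\ y & b\end{pmatrix}\begin{pmatrix} a' & x'\\ y' & b'\end{pmatrix}=\begin{pmatrix} aa'+x\cdot y' & ax'+b'x-y\times y'\\ a'y+by'+x\times x' & x'\cdot y+bb'\end{pmatrix}$$ (a model of the split octonions) and norm $N=ab-x\cdot y$. Let $Q\subset P(\mathcal Z)$ be the quadric of isotropic lines of $N$. For $z\in\mathcal Z$ let $L_z$ and $R_z$ be the left and right multiplications by $z$. The two families $Q_+$, $Q_-$ of maximal totally isotropic subspaces of $\mathcal Z$ are identified with copies of $Q$ by $[z]\mapsto\ker L_z$ and $[z]\mapsto\ker R_z$ respectively. Put $Q_0=Q$, $Q_1=Q_-$, $Q_2=Q_+$, let $$\mathcal I=\{([x_i])_{i\in\mathbb Z/3}\in Q_0\times Q_1\times Q_2 \mid x_ix_{i+1}=0 \text{ for all } i\in\mathbb Z/3\}$$ be the incidence variety, with projections $q_i:\mathcal I\to Q_i$, and let $\xi=\xi_0+\xi_1+\xi_2\subset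 T\mathcal I$, where $\xi_i=\ker Tq_{i+1}\cap\ker Tq_{i-1}$. Let $S$ be a smooth surface (without boundary). A smooth immersion $\varphi:S\to Q$ is called totally isotropic if at every point $p\in S$ its tangent projective plane $\tau_p\varphi\subset P(\mathcal Z)$ is contained in $Q$. Then, for every totally isotropic immersion $\varphi:S\to Q$ and every $p\in S$, there is exactly one point $\varphi_-(p)\in Q_-$ and exactly one point $\varphi_+(p)\in Q_+$ whose corresponding projective $3$-spaces contain $\tau_p\varphi$; and the map $$\varphi\longmapsto\Phi=(\varphi,\varphi_-,\varphi_+)$$ is a bijection from the set of totally isotropic immersions $\varphi:S\to Q$ onto the set of integral surfaces $\Phi:S\to\mathcal I$ of $\xi$ (smooth immersions with $\operatorname{im}T\Phi\subset\xi$) such that $q_0\circ\Phi:S\to Q$ is an immersion. -/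

import Mathlib

open scoped Manifold ContDiff Topology LinearAlgebra.Projectivization

namespace Triality

/-! ## Split octonions (Zorn matrices) -/

/-- The underlying real vector space of the Zorn algebra: the quadruple `(a, x, y, b)` stands for
the Zorn matrix with rows `(a, x)` and `(y, b)`, where `a b : ℝ` and `x y : ℝ³`. -/
abbrev Zorn : Type := ℝ × (Fin 3 → ℝ) × (Fin 3 → ℝ) × ℝ

/-- The product of two Zorn matrices. -/
def zornMul (z w : Zorn) : Zorn :=
  (z.1 * w.1 + z.2.1 ⬝ᵥ w.2.2.1,
   z.1 • w.2.1 + w.2.2.2 • z.2.1 - crossProduct z.2.2.1 w.2.2.1,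
   w.1 • z.2.2.1 + z.2.2.2 • w.2.2.1 + crossProduct z.2.1 w.2.1,
   w.2.1 ⬝ᵥ z.2.2.1 + z.2.2.2 * w.2.2.2)

/-- The product of the Zorn algebra as a bilinear map: `mul z` is the left multiplication `L_z`
and `mul.flip z` is the right multiplication `R_z`. -/
def mul : Zorn →ₗ[ℝ] Zorn →ₗ[ℝ] Zorn :=
  LinearMap.mk₂ ℝ zornMul
    (by
      intro z z' w
      ext i <;> simp [zornMul, add_mul, add_smul, smul_add] <;> ring)
    (by
      intro c z w
      ext i <;> simp [zornMul, -mul_eq_mul_left_iff] <;> ring)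
    (by
      intro z w w'
      ext i <;> simp [zornMul, mul_add, add_smul, smul_add] <;> ring)
    (by
      intro c z w
      ext i <;> simp [zornMul, -mul_eq_mul_left_iff] <;> ring)

/-- The norm (or determinant) `a b - x · y` of a Zorn matrix, a quadratic form of
signature `(4, 4)`. -/
def N (z : Zorn) : ℝ := z.1 * z.2.2.2 - z.2.1 ⬝ᵥ z.2.2.1

/-- The quadric of isotropic lines. -/
def Quadric : Set (ℙ ℝ Zorn) := {l | ∀ v ∈ l.submodule, N v = 0}

/-- `ker L_z` for any `z ≠ 0` on the line `l`.  When `l` runs over the quadric, these are the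
maximal totally isotropic subspaces of the family `Q₊`. -/
def kerL (l : ℙ ℝ Zorn) : Submodule ℝ Zorn := ⨅ z : l.submodule, LinearMap.ker (mul z)

/-- `ker R_z` for any `z ≠ 0` on the line `l`.  When `l` runs over the quadric, these are the
maximal totally isotropic subspaces of the family `Q₋`. -/
def kerR (l : ℙ ℝ Zorn) : Submodule ℝ Zorn := ⨅ z : l.submodule, LinearMap.ker (mul.flip z)

/-! ## Smooth maps from a surface to a projective space -/

section Projective

variable {V : Type*} [NormedAddCommGroup V] [NormedSpace ℝ V]
variable {S : Type*} [TopologicalSpace S] [ChartedSpace (EuclideanSpace ℝ (Fin 2)) S]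

/-- The tangent space `Hom(l, V / l)` of the projective space `P(V)` at the line `l`. -/
abbrev TProj (l : ℙ ℝ V) : Type _ := l.submodule →ₗ[ℝ] (V ⧸ l.submodule)

/-- `ψ` is, near `p`, a smooth nowhere zero lift of `φ : S → P(V)`. -/
def IsLocalLift (φ : S → ℙ ℝ V) (p : S) (ψ : S → V) : Prop :=
  ∃ U : Set S, IsOpen U ∧ p ∈ U ∧ ContMDiffOn (𝓡 2) 𝓘(ℝ, V) ∞ ψ U ∧
    ∀ q ∈ U, ∃ h : ψ q ≠ 0, Projectivization.mk ℝ (ψ q) h = φ q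

/-- Smoothness of a map to `P(V)`: it has smooth lifts to `V ∖ {0}` near every point. -/
def IsSmooth (φ : S → ℙ ℝ V) : Prop := ∀ p, ∃ ψ, IsLocalLift φ p ψ

/-- `D` is the tangent map of `φ : S → P(V)` at `p`: for a local lift `ψ` of `φ`, the tangent
vector `D X`, a linear map from the line `φ p` to `V / φ p`, sends `ψ p` to the class
of `dψ_p(X)`. -/
def HasTangentMap (φ : S → ℙ ℝ V) (p : S)
    (D : TangentSpace (𝓡 2) p →ₗ[ℝ] TProj (φ p)) : Prop :=
  ∃ ψ : S → V, IsLocalLift φ p ψ ∧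
    ∀ (X : TangentSpace (𝓡 2) p) (w : (φ p).submodule), (w : V) = ψ p →
      D X w = (φ p).submodule.mkQ (mfderiv (𝓡 2) 𝓘(ℝ, V) ψ p X)

open Classical in
/-- The tangent map of `φ : S → P(V)` at `p` (zero if there is none). -/
noncomputable def tangentMap (φ : S → ℙ ℝ V) (p : S) :
    TangentSpace (𝓡 2) p →ₗ[ℝ] TProj (φ p) :=
  if h : ∃ D, HasTangentMap φ p D then h.choose else 0

/-- Smooth immersions of a surface in `P(V)`. -/
def IsImmersion (φ : S → ℙ ℝ V) : Prop :=
  IsSmooth φ ∧ ∀ p, Function.Injective (tangentMap φ p)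

/-- The vector subspace `ℝ ψ(p) + im dψ_p` of `V` (for `ψ` a local lift of `φ` at `p`) whose
projectivization is the projective subspace tangent to `φ` at `p`: it consists of the vectors whose
class modulo the line `φ p` belongs to the span of the images of the tangent vectors
`φ p → V / φ p` of `φ` at `p`. -/
noncomputable def tangentPlane (φ : S → ℙ ℝ V) (p : S) : Submodule ℝ V :=
  (⨆ X, LinearMap.range (tangentMap φ p X)).comap (φ p).submodule.mkQ

end Projective

/-! ## Totally isotropic immersions and their Gauss maps -/

section Surfaces

variable {S : Type*} [TopologicalSpace S] [ChartedSpace (EuclideanSpace ℝ (Fin 2)) S]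

/-- Totally isotropic immersions of `S` in the quadric: the tangent projective plane at every
point is contained in the quadric. -/
def IsTotallyIsotropicImmersion (φ : S → ℙ ℝ Zorn) : Prop :=
  IsImmersion φ ∧ (∀ p, φ p ∈ Quadric) ∧ ∀ p, ∀ v ∈ tangentPlane φ p, N v = 0

open Classical in
/-- The map `φ₋`: the subspace `ker R_z`, for `z` on the isotropic line `φ₋(p)`, is the member of
the family `Q₋` which contains the projective plane tangent to `φ` at `p`. -/
noncomputable def gaussMinus (φ : S → ℙ ℝ Zorn) (p : S) : ℙ ℝ Zorn :=
  if h : ∃ l, l ∈ Quadric ∧ tangentPlane φ p ≤ kerR l then h.choose else φ p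

open Classical in
/-- The map `φ₊`: the subspace `ker L_z`, for `z` on the isotropic line `φ₊(p)`, is the member of
the family `Q₊` which contains the projective plane tangent to `φ` at `p`. -/
noncomputable def gaussPlus (φ : S → ℙ ℝ Zorn) (p : S) : ℙ ℝ Zorn :=
  if h : ∃ l, l ∈ Quadric ∧ tangentPlane φ p ≤ kerL l then h.choose else φ p

end Surfaces

/-! ## The incidence variety and its distribution -/

/-- The incidence variety in `Q₀ × Q₁ × Q₂`: triples of isotropic lines `[x₀], [x₁], [x₂]` with
`xᵢ xᵢ₊₁ = 0`, the indices being taken modulo `3`. -/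
def Incidence : Set (Fin 3 → ℙ ℝ Zorn) :=
  {x | (∀ i, x i ∈ Quadric) ∧
    ∀ i, ∀ u ∈ (x i).submodule, ∀ w ∈ (x (i + 1)).submodule, mul u w = 0}

/-- The tangent space of `P(Zorn)³` at `x`. -/
abbrev TProd (x : Fin 3 → ℙ ℝ Zorn) : Type := (i : Fin 3) → TProj (x i)

/-- `v` is the velocity at time `0` of a smooth curve `t ↦ ([c₀(t)], [c₁(t)], [c₂(t)])` drawn on
the incidence variety and starting at `x`. -/
def IsVelocity (x : Fin 3 → ℙ ℝ Zorn) (v : TProd x) : Prop :=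
  ∃ c : Fin 3 → ℝ → Zorn, (∀ i, ContDiff ℝ ∞ (c i)) ∧
    (∀ᶠ t in 𝓝 (0 : ℝ), ∃ h : ∀ i, c i t ≠ 0,
      (fun i => Projectivization.mk ℝ (c i t) (h i)) ∈ Incidence) ∧
    ∀ i, c i 0 ∈ (x i).submodule ∧
      ∀ w : (x i).submodule, (w : Zorn) = c i 0 →
        v i w = (x i).submodule.mkQ (deriv (c i) 0)

/-- The tangent space of the incidence variety at `x`, spanned by the velocities of smooth
curves. -/
noncomputable def tangentIncidence (x : Fin 3 → ℙ ℝ Zorn) : Submodule ℝ (TProd x) :=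
  Submodule.span ℝ {v | IsVelocity x v}

/-- The tangent map at `x` of the projection `qⱼ` to the `j`-th quadric. -/
noncomputable def Tq (x : Fin 3 → ℙ ℝ Zorn) (j : Fin 3) : TProd x →ₗ[ℝ] TProj (x j) := LinearMap.proj j

/-- The vertical tangent space `ξᵢ = ker Tqᵢ₊₁ ∩ ker Tqᵢ₋₁` in the tangent space of the incidence
variety. -/
noncomputable def xiPart (x : Fin 3 → ℙ ℝ Zorn) (i : Fin 3) : Submodule ℝ (TProd x) :=
  tangentIncidence x ⊓ LinearMap.ker (Tq x (i + 1)) ⊓ LinearMap.ker (Tq x (i - 1))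

/-- The distribution `ξ = ξ₀ + ξ₁ + ξ₂`. -/
noncomputable def xi (x : Fin 3 → ℙ ℝ Zorn) : Submodule ℝ (TProd x) := ⨆ i, xiPart x i

section IntegralSurfaces

variable {S : Type*} [TopologicalSpace S] [ChartedSpace (EuclideanSpace ℝ (Fin 2)) S]

/-- The tangent map at `p` of a map from `S` to `P(Zorn)³`. -/
noncomputable def tangentMapProd (Φ : S → Fin 3 → ℙ ℝ Zorn) (p : S) :
    TangentSpace (𝓡 2) p →ₗ[ℝ] TProd (Φ p) :=
  LinearMap.pi fun i => tangentMap (fun s => Φ s i) p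

/-- Integral surfaces of `ξ`: smooth immersions of `S` in the incidence variety, tangent at every
point to the distribution `ξ`. -/
def IsIntegralSurface (Φ : S → Fin 3 → ℙ ℝ Zorn) : Prop :=
  (∀ p, Φ p ∈ Incidence) ∧ (∀ i, IsSmooth fun s => Φ s i) ∧
    (∀ p, Function.Injective (tangentMapProd Φ p)) ∧
    ∀ p X, tangentMapProd Φ p X ∈ xi (Φ p)

end IntegralSurfaces

end Triality

/-! The identity `conj z * (z * w) = N z • w` and its polarization make left multiplication a
Clifford action. If a null vector `w` orthogonal to a family lies outside its span, choose a null
`c` orthogonal to the family with `B w c = 1`. The common kernel of the family then splits into the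
parts killed by `w` and by `c`, which are isomorphic. Three independent vectors spanning an
isotropic space therefore cut the dimension 8 to 4, 2, 1 (`IsoFrame.finrank_commonKer`). Exactly one
line is annihilated by an isotropic plane from the right, and by conjugation exactly one from the
left: these are `φ₋(p)` and `φ₊(p)`. The product `spinor` of three multiplications produces the
annihilating line explicitly, hence smoothly.

A tangent vector lies in `ξ` exactly when each line moves inside the space annihilated by its two
neighbours. For local lifts `f`, `g`, `h` of `φ`, `φ₋`, `φ₊` this means six equations. Two, `df * g
= 0` and `h * df = 0`, define the Gauss maps; differentiating `f * g = 0` and `h * f = 0` gives two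
more. Incidence also needs `g * h = 0`, proved by alternativity and the quadratic equation of a Zorn
matrix (`IsoFrame.mul_eq_zero`); its derivative makes the last two equations equivalent. The
remaining equation `dg * h = 0` is of second order: symmetry of second derivatives makes `df(X) *
dg(Y)` symmetric in `X` and `Y`, and `IsoFrame.mul_eq_zero_of_symm` concludes.

Conversely, tangency to `ξ` puts the tangent plane of the first component inside the isotropic
spaces given by the other two, so uniqueness recovers those components as Gauss maps. -/

namespace Triality

/-! ## Algebra of Zorn matrices -/

/-- The conjugation of the Zorn algebra. -/
def conj : Zorn →ₗ[ℝ] Zorn where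
  toFun z := (z.2.2.2, -z.2.1, -z.2.2.1, z.1)
  map_add' z w := by ext i <;> simp <;> ring
  map_smul' c z := by ext i <;> simp

/-- The polar form of the norm. -/
def B : Zorn →ₗ[ℝ] Zorn →ₗ[ℝ] ℝ :=
  LinearMap.mk₂ ℝ (fun z w => z.1 * w.2.2.2 + w.1 * z.2.2.2 - z.2.1 ⬝ᵥ w.2.2.1 - w.2.1 ⬝ᵥ z.2.2.1)
    (by intro z z' w; simp; ring)
    (by intro c z w; simp; ring)
    (by intro z w w'; simp; ring)
    (by intro c z w; simp; ring)

/-- The unit of the Zorn algebra. -/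
def unit : Zorn := (1, 0, 0, 1)

lemma zorn_ext {z w : Zorn} (h₁ : z.1 = w.1) (h₂ : z.2.1 0 = w.2.1 0) (h₃ : z.2.1 1 = w.2.1 1)
    (h₄ : z.2.1 2 = w.2.1 2) (h₅ : z.2.2.1 0 = w.2.2.1 0) (h₆ : z.2.2.1 1 = w.2.2.1 1)
    (h₇ : z.2.2.1 2 = w.2.2.1 2) (h₈ : z.2.2.2 = w.2.2.2) : z = w := by
  ext i
  · exact h₁
  · fin_cases i <;> assumption
  · fin_cases i <;> assumption
  · exact h₈

section Coordinates

variable (z w : Zorn)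

lemma mul_a : (mul z w).1 =
    z.1 * w.1 + (z.2.1 0 * w.2.2.1 0 + z.2.1 1 * w.2.2.1 1 + z.2.1 2 * w.2.2.1 2) := by
  simp [mul, zornMul, dotProduct, Fin.sum_univ_three]

lemma mul_b : (mul z w).2.2.2 =
    w.2.1 0 * z.2.2.1 0 + w.2.1 1 * z.2.2.1 1 + w.2.1 2 * z.2.2.1 2 + z.2.2.2 * w.2.2.2 := by
  simp [mul, zornMul, dotProduct, Fin.sum_univ_three]

lemma mul_x0 : (mul z w).2.1 0 = z.1 * w.2.1 0 + w.2.2.2 * z.2.1 0 -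
    (z.2.2.1 1 * w.2.2.1 2 - z.2.2.1 2 * w.2.2.1 1) := by
  simp only [mul, LinearMap.mk₂_apply, zornMul, cross_apply]; rfl

lemma mul_x1 : (mul z w).2.1 1 = z.1 * w.2.1 1 + w.2.2.2 * z.2.1 1 -
    (z.2.2.1 2 * w.2.2.1 0 - z.2.2.1 0 * w.2.2.1 2) := by
  simp only [mul, LinearMap.mk₂_apply, zornMul, cross_apply]; rfl

lemma mul_x2 : (mul z w).2.1 2 = z.1 * w.2.1 2 + w.2.2.2 * z.2.1 2 -
    (z.2.2.1 0 * w.2.2.1 1 - z.2.2.1 1 * w.2.2.1 0) := by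
  simp only [mul, LinearMap.mk₂_apply, zornMul, cross_apply]; rfl

lemma mul_y0 : (mul z w).2.2.1 0 = w.1 * z.2.2.1 0 + z.2.2.2 * w.2.2.1 0 +
    (z.2.1 1 * w.2.1 2 - z.2.1 2 * w.2.1 1) := by
  simp only [mul, LinearMap.mk₂_apply, zornMul, cross_apply]; rfl

lemma mul_y1 : (mul z w).2.2.1 1 = w.1 * z.2.2.1 1 + z.2.2.2 * w.2.2.1 1 +
    (z.2.1 2 * w.2.1 0 - z.2.1 0 * w.2.1 2) := by
  simp only [mul, LinearMap.mk₂_apply, zornMul, cross_apply]; rfl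

lemma mul_y2 : (mul z w).2.2.1 2 = w.1 * z.2.2.1 2 + z.2.2.2 * w.2.2.1 2 +
    (z.2.1 0 * w.2.1 1 - z.2.1 1 * w.2.1 0) := by
  simp only [mul, LinearMap.mk₂_apply, zornMul, cross_apply]; rfl

end Coordinates

lemma conj_apply (z : Zorn) : conj z = (z.2.2.2, -z.2.1, -z.2.2.1, z.1) := rfl

lemma B_apply (z w : Zorn) : B z w =
    z.1 * w.2.2.2 + w.1 * z.2.2.2 - z.2.1 ⬝ᵥ w.2.2.1 - w.2.1 ⬝ᵥ z.2.2.1 := rfl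

@[simp] lemma conj_conj (z : Zorn) : conj (conj z) = z := by
  ext i <;> simp [conj_apply]

lemma conj_injective : Function.Injective conj := fun x y h => by
  rw [← conj_conj x, h, conj_conj]

@[simp] lemma N_conj (z : Zorn) : N (conj z) = N z := by
  simp [conj_apply, N]; ring

@[simp] lemma B_conj_conj (z w : Zorn) : B (conj z) (conj w) = B z w := by
  simp [conj_apply, B_apply]; ring

lemma B_comm (z w : Zorn) : B z w = B w z := by
  simp [B_apply]; ring

lemma N_add (z w : Zorn) : N (z + w) = N z + N w + B z w := by
  simp [N, B_apply]; ring

lemma N_smul (c : ℝ) (z : Zorn) : N (c • z) = c ^ 2 * N z := by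
  simp [N]; ring

lemma B_self (z : Zorn) : B z z = 2 * N z := by
  simp [N, B_apply]; ring

/-! ### Conjugation, Clifford relations and alternativity -/

lemma conj_mul (z w : Zorn) : conj (mul z w) = mul (conj w) (conj z) := by
  apply zorn_ext <;>
    simp only [mul_a, mul_b, mul_x0, mul_x1, mul_x2, mul_y0, mul_y1, mul_y2,
      conj_apply, Pi.neg_apply] <;>
    ring

lemma mul_conj_mul_self (z w : Zorn) : mul z (mul (conj z) w) = N z • w := by
  apply zorn_ext <;>
    simp only [mul_a, mul_b, mul_x0, mul_x1, mul_x2, mul_y0, mul_y1, mul_y2,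
      conj_apply, N, dotProduct, Fin.sum_univ_three, Pi.neg_apply, Pi.smul_apply,
      Prod.smul_fst, Prod.smul_snd, smul_eq_mul] <;>
    ring

lemma conj_mul_mul_self (z w : Zorn) : mul (conj z) (mul z w) = N z • w := by
  simpa using mul_conj_mul_self (conj z) w

lemma mul_conj_mul_add (x y u : Zorn) :
    mul x (mul (conj y) u) + mul y (mul (conj x) u) = B x y • u := by
  have h := mul_conj_mul_self (x + y) u
  simp only [map_add, LinearMap.add_apply, N_add, add_smul, mul_conj_mul_self] at h
  rw [← add_right_inj (N x • u + N y • u), ← h]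
  abel

lemma conj_mul_mul_add (x y u : Zorn) :
    mul (conj x) (mul y u) + mul (conj y) (mul x u) = B x y • u := by
  simpa using mul_conj_mul_add (conj x) (conj y) u

lemma mul_conj_swap {x y : Zorn} (h : B x y = 0) (u : Zorn) :
    mul x (mul (conj y) u) = - mul y (mul (conj x) u) := by
  rw [eq_neg_iff_add_eq_zero, mul_conj_mul_add, h, zero_smul]

lemma conj_mul_swap {x y : Zorn} (h : B x y = 0) (u : Zorn) :
    mul (conj x) (mul y u) = - mul (conj y) (mul x u) := by
  rw [eq_neg_iff_add_eq_zero, conj_mul_mul_add, h, zero_smul]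

/-- Conjugation turns the Clifford relation for left multiplications into this one for right
multiplications. -/
lemma mul_mul_add (x u y : Zorn) :
    mul (mul x u) y + mul (mul x (conj y)) (conj u) = B u (conj y) • x := by
  apply conj_injective
  have := mul_conj_mul_add (conj y) u (conj x)
  simp only [map_add, conj_mul, conj_conj, map_smul] at *
  rw [B_comm, this]

/-- Alternativity enters only through this cyclic invariance of the associator. -/
lemma associator_cyclic (u x y : Zorn) :
    mul (mul u x) y - mul u (mul x y) = mul (mul y u) x - mul y (mul u x) := by
  apply zorn_ext <;>
    simp only [mul_a, mul_b, mul_x0, mul_x1, mul_x2, mul_y0, mul_y1, mul_y2,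
      Pi.sub_apply, Prod.fst_sub, Prod.snd_sub] <;>
    ring

/-- Polarization of the quadratic equation `t² = tr(t) t - N(t) 1`, the trace being `B t unit`. -/
lemma mul_add_mul_comm (u t : Zorn) :
    mul u t + mul t u = B u unit • t + B t unit • u - B u t • unit := by
  apply zorn_ext <;>
    simp only [mul_a, mul_b, mul_x0, mul_x1, mul_x2, mul_y0, mul_y1, mul_y2,
      B_apply, unit, dotProduct, Fin.sum_univ_three, Pi.smul_apply,
      Pi.add_apply, Pi.sub_apply, Pi.zero_apply, Prod.fst_add, Prod.snd_add, Prod.fst_sub,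
      Prod.snd_sub, Prod.smul_fst, Prod.smul_snd, smul_eq_mul] <;>
    ring

lemma N_left_eq_zero {w z : Zorn} (hz : z ≠ 0) (h : mul w z = 0) : N w = 0 := by
  have := conj_mul_mul_self w z
  rw [h, map_zero] at this
  exact (smul_eq_zero.1 this.symm).resolve_right hz

lemma N_right_eq_zero {w z : Zorn} (hw : w ≠ 0) (h : mul w z = 0) : N z = 0 := by
  rw [← N_conj]
  refine N_left_eq_zero (z := conj w) (fun h0 => hw ?_) (by rw [← conj_mul, h, map_zero])
  rw [← conj_conj w, h0, map_zero]

lemma mul_injective {w : Zorn} (hw : N w ≠ 0) : Function.Injective (mul w) := by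
  refine (injective_iff_map_eq_zero _).2 fun z hz => ?_
  by_contra h
  exact hw (N_left_eq_zero h hz)

/-! ### Isotropic subspaces and the polar form -/

lemma exists_B_eq (f : Zorn →ₗ[ℝ] ℝ) : ∃ c, ∀ w, B w c = f w := by
  classical
  refine ⟨(f (0, 0, 0, 1), fun i => - f (0, 0, Pi.single i 1, 0),
    fun i => - f (0, Pi.single i 1, 0, 0), f (1, 0, 0, 0)), fun w => ?_⟩
  have hw : w = w.1 • ((1, 0, 0, 0) : Zorn) + (∑ i, w.2.1 i • ((0, Pi.single i 1, 0, 0) : Zorn))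
      + (∑ i, w.2.2.1 i • ((0, 0, Pi.single i 1, 0) : Zorn)) + w.2.2.2 • ((0, 0, 0, 1) : Zorn) := by
    ext i
    · simp [Fin.sum_univ_three]
    · fin_cases i <;> simp [Fin.sum_univ_three]
    · fin_cases i <;> simp [Fin.sum_univ_three]
    · simp [Fin.sum_univ_three]
  conv_rhs => rw [hw]
  simp only [map_add, map_smul, B_apply, dotProduct, Fin.sum_univ_three, smul_eq_mul]
  ring

lemma exists_dual {W : Submodule ℝ Zorn} {w : Zorn} (h : w ∉ W) :
    ∃ c, B w c = 1 ∧ ∀ a ∈ W, B a c = 0 := by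
  obtain ⟨f, hf, hW⟩ := Submodule.exists_dual_map_eq_bot_of_notMem h inferInstance
  obtain ⟨c, hc⟩ := exists_B_eq ((f w)⁻¹ • f)
  refine ⟨c, by simp [hc, hf], fun a ha => ?_⟩
  have : f a = 0 := by
    have : f a ∈ W.map f := Submodule.mem_map_of_mem ha
    simpa [hW] using this
  simp [hc, this]

lemma exists_null_dual {W : Submodule ℝ Zorn} {w : Zorn} (h : w ∉ W) (hw : N w = 0)
    (hW : ∀ a ∈ W, B a w = 0) : ∃ c, N c = 0 ∧ B w c = 1 ∧ ∀ a ∈ W, B a c = 0 := by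
  obtain ⟨c, h1, h2⟩ := exists_dual h
  -- Moving `c` along `w` changes no prescribed pairing, as `w` is null and orthogonal to `W`; the
  -- coefficient solves `N (c + s • w) = N c + s = 0`.
  refine ⟨c + (- N c) • w, ?_, ?_, fun a ha => ?_⟩
  · rw [N_add, N_smul, hw, map_smul, B_comm, h1]; simp
  · rw [map_add, map_smul, B_self, h1, hw]; simp
  · rw [map_add, map_smul, h2 a ha, hW a ha]; simp

/-- The vectors killed by the left multiplications by the elements of a set. -/
def commonKer (s : Set Zorn) : Submodule ℝ Zorn where
  carrier := {u | ∀ a ∈ s, mul a u = 0}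
  add_mem' hu hv a ha := by rw [map_add, hu a ha, hv a ha, add_zero]
  zero_mem' a _ := map_zero _
  smul_mem' c u hu a ha := by rw [map_smul, hu a ha, smul_zero]

lemma mem_commonKer {s : Set Zorn} {u : Zorn} : u ∈ commonKer s ↔ ∀ a ∈ s, mul a u = 0 := Iff.rfl

/-- The kernel of `f` is a four-dimensional space on which `N = -(a² + x · x)` is negative definite,
so it meets an isotropic space only in zero. -/
lemma finrank_le_four {T : Submodule ℝ Zorn} (h : ∀ v ∈ T, N v = 0) : Module.finrank ℝ T ≤ 4 := by
  let f : Zorn →ₗ[ℝ] ℝ × (Fin 3 → ℝ) :=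
    { toFun := fun z => (z.1 + z.2.2.2, z.2.1 - z.2.2.1)
      map_add' := fun z w => by ext i <;> simp <;> ring
      map_smul' := fun c z => by ext i <;> simp <;> ring }
  have hinj : Function.Injective (f.domRestrict T) := by
    refine (injective_iff_map_eq_zero _).2 fun z hz => ?_
    obtain ⟨⟨a, x, y, b⟩, hzT⟩ := z
    have h0 := h _ hzT
    have h1 : a + b = 0 := congrArg Prod.fst hz
    have h2 : x - y = 0 := congrArg Prod.snd hz
    obtain rfl : x = y := sub_eq_zero.1 h2
    obtain rfl : b = -a := by linarith
    simp only [N, dotProduct, Fin.sum_univ_three] at h0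
    have ha : a = 0 := by nlinarith [sq_nonneg a, sq_nonneg (x 0), sq_nonneg (x 1), sq_nonneg (x 2)]
    have hx0 : x 0 = 0 := by
      nlinarith [sq_nonneg a, sq_nonneg (x 0), sq_nonneg (x 1), sq_nonneg (x 2)]
    have hx1 : x 1 = 0 := by
      nlinarith [sq_nonneg a, sq_nonneg (x 0), sq_nonneg (x 1), sq_nonneg (x 2)]
    have hx2 : x 2 = 0 := by
      nlinarith [sq_nonneg a, sq_nonneg (x 0), sq_nonneg (x 1), sq_nonneg (x 2)]
    have hx : x = 0 := by ext i; fin_cases i <;> assumption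
    subst hx ha
    ext <;> simp
  simpa using LinearMap.finrank_le_finrank_of_injective hinj

/-- The four orthogonality conditions leave dimension at least 4. Were the solution space totally
null, adjoining `w`, which lies outside because `B w c = 1`, would give an isotropic space of
dimension 5. -/
lemma exists_nonnull {w c : Zorn} (a b : Zorn) (hw : N w = 0) (hwc : B w c = 1) : ∃ n, N n ≠ 0 ∧ B a n = 0 ∧ B b n = 0 ∧ B w n = 0 ∧ B c n = 0 := by
  by_contra! hcon
  let f : Zorn →ₗ[ℝ] Fin 4 → ℝ := LinearMap.pi ![B a, B b, B w, B c]
  have hmem : ∀ v, v ∈ LinearMap.ker f ↔ B a v = 0 ∧ B b v = 0 ∧ B w v = 0 ∧ B c v = 0 := by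
    intro v
    simp [f, funext_iff, Fin.forall_fin_succ, LinearMap.mem_ker]
  have hT : ∀ v ∈ LinearMap.ker f, N v = 0 := by
    intro v hv
    rw [hmem] at hv
    by_contra h
    exact hcon v h hv.1 hv.2.1 hv.2.2.1 hv.2.2.2
  have hrank := LinearMap.finrank_range_add_finrank_ker f
  have hr : Module.finrank ℝ (LinearMap.range f) ≤ 4 := by
    simpa using Submodule.finrank_le (LinearMap.range f)
  have h8 : Module.finrank ℝ Zorn = 8 := by simp
  have hwT : w ∉ LinearMap.ker f := fun h => by
    have := ((hmem w).1 h).2.2.2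
    rw [B_comm] at this
    linarith
  have hlt : LinearMap.ker f < LinearMap.ker f ⊔ Submodule.span ℝ {w} := by
    refine lt_of_le_of_ne le_sup_left fun h => hwT ?_
    rw [h]
    exact Submodule.mem_sup_right (Submodule.mem_span_singleton_self w)
  have h5 := Submodule.finrank_lt_finrank_of_lt hlt
  have h4 : Module.finrank ℝ (LinearMap.ker f ⊔ Submodule.span ℝ {w} : Submodule ℝ Zorn) ≤ 4 := by
    refine finrank_le_four fun v hv => ?_
    obtain ⟨t, ht, s, hs, rfl⟩ := Submodule.mem_sup.1 hv
    obtain ⟨r, rfl⟩ := Submodule.mem_span_singleton.1 hs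
    rw [N_add, hT t ht, N_smul, hw, map_smul, B_comm, ((hmem t).1 ht).2.2.1]
    simp
  omega

lemma finrank_commonKer_le {s : Set Zorn} {w c n : Zorn} (hc : N c = 0) (hw : N w = 0)
    (hwc : B w c = 1) (hsw : ∀ a ∈ s, B a w = 0) (hsc : ∀ a ∈ s, B a c = 0) (hn : N n ≠ 0)
    (hsn : ∀ a ∈ s, B a n = 0) (hcn : B c n = 0) :
    Module.finrank ℝ (commonKer (insert w s)) ≤ Module.finrank ℝ (commonKer (insert c s)) := by
  have hm : N (w - c) = -1 := by
    rw [sub_eq_add_neg, ← neg_one_smul ℝ c, N_add, N_smul, hw, hc, map_smul, hwc]; simp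
  -- Multiplication by `w - c` exchanges the roles of `w` and `c` but lands in the other half-spin
  -- space, where conjugates act; the factor `conj n` brings it back.
  let f : Zorn →ₗ[ℝ] Zorn := mul (conj n) ∘ₗ mul (w - c)
  have hf : Function.Injective f :=
    (mul_injective (by rwa [N_conj])).comp (mul_injective (by rw [hm]; norm_num))
  have hle : (commonKer (insert w s)).map f ≤ commonKer (insert c s) := by
    rintro _ ⟨u, hu, rfl⟩
    have hu' := mem_commonKer.1 hu
    refine mem_commonKer.2 fun a ha => ?_
    rcases Set.mem_insert_iff.1 ha with rfl | ha
    · change mul a (mul (conj n) (mul (w - a) u)) = 0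
      rw [mul_conj_swap hcn, map_sub, LinearMap.sub_apply, map_sub, conj_mul_mul_self, hc,
        hu' w (Set.mem_insert _ _)]
      simp
    · change mul a (mul (conj n) (mul (w - c) u)) = 0
      rw [mul_conj_swap (hsn a ha), conj_mul_swap (by rw [map_sub, hsw a ha, hsc a ha, sub_zero]),
        hu' a (Set.mem_insert_of_mem _ ha)]
      simp
  calc _ = Module.finrank ℝ ((commonKer (insert w s)).map f) :=
        (LinearEquiv.finrank_eq (Submodule.equivMapOfInjective f hf _))
    _ ≤ _ := Submodule.finrank_mono hle

/-- The relation `conj w * (c * u) + conj c * (w * u) = u` splits each `u` into a part killed by `w`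
and a part killed by `c`; anticommutation keeps both in the common kernel of `s`. -/
lemma finrank_commonKer_add {s : Set Zorn} {w c : Zorn} (hc : N c = 0) (hw : N w = 0)
    (hwc : B w c = 1) (hsw : ∀ a ∈ s, B a w = 0) (hsc : ∀ a ∈ s, B a c = 0) :
    Module.finrank ℝ (commonKer (insert w s)) + Module.finrank ℝ (commonKer (insert c s)) =
      Module.finrank ℝ (commonKer s) := by
  have hinf : commonKer (insert w s) ⊓ commonKer (insert c s) = ⊥ := by
    refine (Submodule.eq_bot_iff _).2 fun u hu => ?_
    have h := conj_mul_mul_add w c u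
    rw [hu.1 w (Set.mem_insert _ _), hu.2 c (Set.mem_insert _ _), hwc] at h
    simpa using h.symm
  have hsup : commonKer (insert w s) ⊔ commonKer (insert c s) = commonKer s := by
    refine le_antisymm (sup_le ?_ ?_) fun u hu => ?_
    · exact fun u hu a ha => hu a (Set.mem_insert_of_mem _ ha)
    · exact fun u hu a ha => hu a (Set.mem_insert_of_mem _ ha)
    · have h := conj_mul_mul_add w c u
      rw [hwc, one_smul] at h
      rw [← h]
      refine Submodule.add_mem_sup (fun a ha => ?_) (fun a ha => ?_)
      · rcases Set.mem_insert_iff.1 ha with rfl | ha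
        · rw [mul_conj_mul_self, hw, zero_smul]
        · rw [mul_conj_swap (hsw a ha), conj_mul_swap (hsc a ha), hu a ha]; simp
      · rcases Set.mem_insert_iff.1 ha with rfl | ha
        · rw [mul_conj_mul_self, hc, zero_smul]
        · rw [mul_conj_swap (hsc a ha), conj_mul_swap (hsw a ha), hu a ha]; simp
  have := Submodule.finrank_sup_add_finrank_inf_eq (commonKer (insert w s)) (commonKer (insert c s))
  rw [hinf, hsup, finrank_bot] at this
  omega

lemma two_mul_finrank_commonKer {a b w : Zorn} (hw : N w = 0) (haw : B a w = 0) (hbw : B b w = 0)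
    (h : w ∉ Submodule.span ℝ {a, b}) :
    2 * Module.finrank ℝ (commonKer {w, a, b}) = Module.finrank ℝ (commonKer {a, b}) := by
  have hsw : ∀ x ∈ ({a, b} : Set Zorn), B x w = 0 := by
    rintro x (rfl | rfl) <;> assumption
  obtain ⟨c, hc, hwc, hW⟩ := exists_null_dual h hw fun x hx => by
    obtain ⟨r, t, rfl⟩ := Submodule.mem_span_pair.1 hx
    simp [haw, hbw]
  obtain ⟨n, hn, han, hbn, hwn, hcn⟩ := exists_nonnull a b hw hwc
  have hsn : ∀ x ∈ ({a, b} : Set Zorn), B x n = 0 := by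
    rintro x (rfl | rfl) <;> assumption
  have hsc : ∀ x ∈ ({a, b} : Set Zorn), B x c = 0 := fun x hx => hW x (Submodule.subset_span hx)
  have h1 := finrank_commonKer_le hc hw hwc hsw hsc hn hsn hcn
  have h2 := finrank_commonKer_le hw hc (by rwa [B_comm]) hsc hsw hn hsn hwn
  have h3 := finrank_commonKer_add hc hw hwc hsw hsc
  omega

/-- A frame of a totally isotropic subspace of dimension three. -/
structure IsoFrame (w : Fin 3 → Zorn) : Prop where
  indep : LinearIndependent ℝ w
  null : ∀ i, N (w i) = 0
  orth : ∀ i j, B (w i) (w j) = 0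

lemma IsoFrame.of_span {w : Fin 3 → Zorn} (hw : LinearIndependent ℝ w)
    (h : ∀ v ∈ Submodule.span ℝ (Set.range w), N v = 0) : IsoFrame w where
  indep := hw
  null i := h _ (Submodule.subset_span ⟨i, rfl⟩)
  orth i j := by
    have hi : w i ∈ Submodule.span ℝ (Set.range w) := Submodule.subset_span ⟨i, rfl⟩
    have hj : w j ∈ Submodule.span ℝ (Set.range w) := Submodule.subset_span ⟨j, rfl⟩
    have := N_add (w i) (w j)
    rw [h _ (add_mem hi hj), h _ hi, h _ hj] at this
    linarith

lemma IsoFrame.finrank_commonKer {w : Fin 3 → Zorn} (hw : IsoFrame w) :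
    Module.finrank ℝ (commonKer (Set.range w)) = 1 := by
  have hind : LinearIndependent ℝ ![w 0, w 1, w 2] := by
    convert hw.indep using 1
    ext i : 1
    fin_cases i <;> rfl
  have h0 : w 0 ∉ Submodule.span ℝ {w 1, w 2} := by
    have := (linearIndependent_finCons.1 hind).2
    simpa [Matrix.range_cons, Set.pair_comm] using this
  have hind' := (linearIndependent_finCons.1 hind).1
  have h1 : w 1 ∉ Submodule.span ℝ {w 2, 0} := by
    have := (linearIndependent_finCons.1 hind').2
    rw [Set.pair_comm, Submodule.span_insert_zero]
    simpa [Matrix.range_cons] using this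
  have h2 : w 2 ∉ Submodule.span ℝ {(0 : Zorn), 0} := by
    simpa using hw.indep.ne_zero 2
  -- Padding with zero vectors lets one halving lemma treat families of two, one and no vectors.
  have e0 := two_mul_finrank_commonKer (hw.null 0) (hw.orth 1 0) (hw.orth 2 0) h0
  have e1 := two_mul_finrank_commonKer (hw.null 1) (hw.orth 2 1) (by simp) h1
  have e2 := two_mul_finrank_commonKer (hw.null 2) (by simp) (by simp) h2
  have z2 : commonKer {w 2, 0, 0} = commonKer {w 2, 0} := by simp
  have z1 : commonKer {w 1, w 2, 0} = commonKer {w 1, w 2} := by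
    ext u; simp [mem_commonKer]
  have z0 : commonKer {(0 : Zorn), 0} = ⊤ := by
    ext u; simp [mem_commonKer]
  have z3 : commonKer (Set.range w) = commonKer {w 0, w 1, w 2} := by
    congr 1
    ext v : 1
    simp [Fin.exists_fin_succ, eq_comm]
  have h8 : Module.finrank ℝ Zorn = 8 := by simp
  rw [z0, z2, finrank_top, h8] at e2
  rw [z1] at e1
  rw [z3]
  omega

/-! ### Explicit pure spinors -/

lemma IsoFrame.exists_dual {w : Fin 3 → Zorn} (hw : IsoFrame w) (i : Fin 3) :
    ∃ c, ∀ j, B (w j) c = if j = i then 1 else 0 := by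
  have h := (linearIndependent_iff_notMem_span.1 hw.indep) i
  obtain ⟨c, h1, h2⟩ := Triality.exists_dual h
  refine ⟨c, fun j => ?_⟩
  split_ifs with hj
  · rw [hj, h1]
  · exact h2 _ (Submodule.subset_span ⟨j, by simp [hj], rfl⟩)

/-- The pure spinor attached to a frame. -/
def spinor (w : Fin 3 → Zorn) (u : Zorn) : Zorn := mul (conj (w 0)) (mul (w 1) (mul (conj (w 2)) u))

lemma IsoFrame.mul_spinor {w : Fin 3 → Zorn} (hw : IsoFrame w) (u : Zorn) (i : Fin 3) :
    mul (w i) (spinor w u) = 0 := by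
  unfold spinor
  fin_cases i
  · change mul (w 0) _ = 0
    rw [mul_conj_mul_self, hw.null, zero_smul]
  · change mul (w 1) _ = 0
    rw [mul_conj_swap (hw.orth 1 0), conj_mul_mul_self, hw.null]
    simp
  · change mul (w 2) _ = 0
    rw [mul_conj_swap (hw.orth 2 0), conj_mul_swap (hw.orth 2 1), mul_conj_mul_self, hw.null]
    simp

lemma mul_conj_mul_of_dual {w c u : Zorn} (h : B w c = 1) (hu : mul (conj w) u = 0) :
    mul w (mul (conj c) u) = u := by
  have := mul_conj_mul_add w c u
  rwa [hu, map_zero, add_zero, h, one_smul] at this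

lemma conj_mul_mul_of_dual {w c u : Zorn} (h : B w c = 1) (hu : mul w u = 0) :
    mul (conj w) (mul c u) = u := by
  have := conj_mul_mul_add w c u
  rwa [hu, map_zero, add_zero, h, one_smul] at this

/-- Multiplying by the dual vectors `c0`, `c1`, `c2` undoes the three factors of the spinor. Thus a
fixed `u` can be chosen with a nonzero spinor at a given point, hence nearby. -/
lemma IsoFrame.exists_spinor_eq {w : Fin 3 → Zorn} (hw : IsoFrame w) {z : Zorn}
    (hz : ∀ i, mul (w i) z = 0) : ∃ u, spinor w u = z := by
  obtain ⟨c0, h0⟩ := hw.exists_dual 0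
  obtain ⟨c1, h1⟩ := hw.exists_dual 1
  obtain ⟨c2, h2⟩ := hw.exists_dual 2
  have a1 : mul (conj (w 1)) (mul c0 z) = 0 := by
    rw [conj_mul_swap (by simp [h0]), hz, map_zero, neg_zero]
  have a2 : mul (w 2) (mul (conj c1) (mul c0 z)) = 0 := by
    rw [mul_conj_swap (by simp [h1]), conj_mul_swap (by simp [h0]), hz]; simp
  refine ⟨mul c2 (mul (conj c1) (mul c0 z)), ?_⟩
  unfold spinor
  rw [conj_mul_mul_of_dual (by simp [h2]) a2, mul_conj_mul_of_dual (by simp [h1]) a1,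
    conj_mul_mul_of_dual (by simp [h0]) (hz 0)]

/-! ### The two annihilating lines of an isotropic frame -/

lemma IsoFrame.exists_right {w : Fin 3 → Zorn} (hw : IsoFrame w) :
    ∃ z, z ≠ 0 ∧ (∀ i, mul (w i) z = 0) ∧ ∀ z', (∀ i, mul (w i) z' = 0) → ∃ r : ℝ, z' = r • z := by
  obtain ⟨z, hz0, hz⟩ := finrank_eq_one_iff'.1 hw.finrank_commonKer
  refine ⟨z, by simpa using hz0, fun i => z.2 _ ⟨i, rfl⟩, fun z' hz' => ?_⟩
  obtain ⟨r, hr⟩ := hz ⟨z', by rintro _ ⟨i, rfl⟩; exact hz' i⟩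
  exact ⟨r, (congrArg Subtype.val hr).symm⟩

lemma IsoFrame.conj {w : Fin 3 → Zorn} (hw : IsoFrame w) : IsoFrame fun i => conj (w i) where
  indep := hw.indep.map' Triality.conj (LinearMap.ker_eq_bot.2 conj_injective)
  null i := by simp [hw.null]
  orth i j := by simp [hw.orth]

lemma conj_mul_eq_zero_iff {x y : Zorn} : mul (conj x) y = 0 ↔ mul (conj y) x = 0 := by
  rw [← map_eq_zero_iff _ conj_injective, conj_mul, conj_conj]

lemma IsoFrame.exists_left {w : Fin 3 → Zorn} (hw : IsoFrame w) :
    ∃ y, y ≠ 0 ∧ (∀ i, mul y (w i) = 0) ∧ ∀ y', (∀ i, mul y' (w i) = 0) → ∃ r : ℝ, y' = r • y := by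
  obtain ⟨z, hz0, hz, hu⟩ := hw.conj.exists_right
  refine ⟨Triality.conj z, by rwa [Ne, map_eq_zero_iff _ conj_injective],
    fun i => conj_mul_eq_zero_iff.1 (hz i), fun y' hy' => ?_⟩
  obtain ⟨r, hr⟩ := hu (Triality.conj y') fun i => by rw [← conj_mul, hy', map_zero]
  exact ⟨r, by rw [← conj_conj y', hr, map_smul]⟩

lemma IsoFrame.mul_eq_zero {w : Fin 3 → Zorn} (hw : IsoFrame w) {z y : Zorn}
    (hz : ∀ i, mul (w i) z = 0) (hy : ∀ i, mul y (w i) = 0) : mul z y = 0 := by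
  by_contra ht
  set t := mul z y with ht'
  -- Cyclic invariance of the associator transfers the annihilation of `z` and `y` to their product,
  -- on both sides.
  have hut : ∀ i, mul (w i) t = 0 := fun i => by
    have := associator_cyclic (w i) z y
    rw [hz, hy] at this
    simpa using this
  have htu : ∀ i, mul t (w i) = 0 := fun i => by
    have h1 := associator_cyclic z y (w i)
    rw [hz, hy, ← ht', hut] at h1
    simpa using h1
  have hz0 : z ≠ 0 := by rintro rfl; simp [ht'] at ht
  have hy0 : y ≠ 0 := by rintro rfl; simp [ht'] at ht
  have hNt : N t = 0 := N_left_eq_zero (hw.indep.ne_zero 0) (htu 0)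
  obtain ⟨z₁, -, -, huz⟩ := hw.exists_right
  obtain ⟨y₁, -, -, huy⟩ := hw.exists_left
  obtain ⟨a, ha⟩ := huz z hz
  obtain ⟨a', ha'⟩ := huz t hut
  obtain ⟨b, hb⟩ := huy y hy
  obtain ⟨b', hb'⟩ := huy t htu
  have ha0 : a' ≠ 0 := by rintro rfl; simp [ha'] at ht
  have hb0 : b' ≠ 0 := by rintro rfl; simp [hb'] at ht
  -- With nonzero trace, the polarized quadratic equation for `w i` and `t` would put the three
  -- independent `w i` in the span of `t` and the unit.
  have htr : B t unit = 0 := by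
    by_contra htr
    have hmem : ∀ i, w i ∈ Submodule.span ℝ {t, unit} := fun i => by
      have h := mul_add_mul_comm (w i) t
      rw [hut, htu, add_zero] at h
      refine Submodule.mem_span_pair.2
        ⟨-(B t unit)⁻¹ * B (w i) unit, (B t unit)⁻¹ * B (w i) t, ?_⟩
      have h' : B t unit • w i = B (w i) t • unit - B (w i) unit • t := by
        rw [eq_sub_iff_add_eq, add_comm]
        rw [eq_comm, sub_eq_zero] at h
        exact h
      rw [← inv_smul_smul₀ htr (w i)]
      conv_rhs => rw [h', smul_sub, smul_smul, smul_smul]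
      rw [inv_smul_smul₀ htr]
      module
    have h3 : Module.finrank ℝ (Submodule.span ℝ (Set.range w)) = 3 := by
      simpa using finrank_span_eq_card hw.indep
    have hle : Submodule.span ℝ (Set.range w) ≤ Submodule.span ℝ {t, unit} := by
      rw [Submodule.span_le]
      rintro _ ⟨i, rfl⟩
      exact hmem i
    have := Submodule.finrank_mono hle
    have h2 := finrank_span_finset_le_card (R := ℝ) ({t, unit} : Finset Zorn)
    have h4 := Finset.card_le_two (a := t) (b := unit)
    rw [Finset.coe_pair, Set.finrank] at h2
    omega
  have htt : mul t t = 0 := by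
    have h := mul_add_mul_comm t t
    rw [htr, B_self, hNt] at h
    have h2 : (2 : ℝ) • mul t t = 0 := by rw [two_smul, h]; simp
    simpa using h2
  apply ht
  -- Both annihilating lines contain `t`, so `z` and `y` are multiples of `t` and their product is a
  -- multiple of `t² = 0`.
  have h1 : z = (a * a'⁻¹) • t := by rw [ha, ha', smul_smul, mul_assoc, inv_mul_cancel₀ ha0, mul_one]
  have h2 : y = (b * b'⁻¹) • t := by rw [hb, hb', smul_smul, mul_assoc, inv_mul_cancel₀ hb0, mul_one]
  rw [ht', h1, h2]
  simp [htt]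

/-! ### The second order condition -/

/-- With `B x c = 1`, the relation `x * u = 0` gives `u = conj x * (c * u)`. Applying `mul_mul_add`,
the second term contains `conj x * conj y = conj (y * x) = 0`. -/
lemma exists_mul_eq_smul_conj {x u y : Zorn} (hx : x ≠ 0) (hu : mul x u = 0) (hy : mul y x = 0) :
    ∃ r : ℝ, mul u y = r • conj x := by
  obtain ⟨c, hc, -⟩ := exists_dual (W := ⊥) (w := x) (by simpa using hx)
  have h := mul_mul_add (conj x) (mul c u) y
  rw [conj_mul_mul_of_dual hc hu, ← conj_mul, hy] at h
  exact ⟨_, by simpa using h⟩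

/-- The product is proportional to both `conj e₁` and `conj e₂`, which are independent. -/
lemma mul_eq_zero_of_pair {e₁ e₂ u y : Zorn} (he : LinearIndependent ℝ ![e₁, e₂])
    (h₁ : mul e₁ u = 0) (h₂ : mul e₂ u = 0) (hy₁ : mul y e₁ = 0) (hy₂ : mul y e₂ = 0) :
    mul u y = 0 := by
  obtain ⟨r, hr⟩ := exists_mul_eq_smul_conj (he.ne_zero 0) h₁ hy₁
  obtain ⟨s, hs⟩ := exists_mul_eq_smul_conj (he.ne_zero 1) h₂ hy₂
  have h : conj (r • e₁ + (-s) • e₂) = 0 := by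
    rw [map_add, map_smul, map_smul]
    change r • conj (![e₁, e₂] 0) + (-s) • conj (![e₁, e₂] 1) = 0
    rw [← hr, neg_smul, ← hs, add_neg_cancel]
  rw [map_eq_zero_iff _ conj_injective] at h
  have := (LinearIndependent.pair_iff.1 he _ _ h).1
  rw [hr, this, zero_smul]

lemma IsoFrame.mul_eq_zero_of_symm {w : Fin 3 → Zorn} (hw : IsoFrame w) {y u₁ u₂ : Zorn}
    (hy : ∀ i, mul y (w i) = 0) (h₁ : mul (w 0) u₁ = 0)
    (h : mul (w 1) u₂ = mul (w 2) u₁) : mul u₁ y = 0 := by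
  obtain ⟨c, hc⟩ := hw.exists_dual 1
  have hp : ∀ i, i ≠ 0 → LinearIndependent ℝ ![w 0, w i] := fun i hi => by
    have := hw.indep.comp ![0, i] (by
      intro a b; fin_cases a <;> fin_cases b <;> simp [hi, Ne.symm hi])
    convert this using 1
    ext a : 1
    fin_cases a <;> rfl
  have hdec := conj_mul_mul_add (w 1) c u₁
  have hc1 : B (w 1) c = 1 := by simp [hc]
  rw [hc1, one_smul] at hdec
  have hA : mul (Triality.conj (w 1)) (mul c u₁) ∈ LinearMap.ker (mul.flip y) := by
    refine mul_eq_zero_of_pair (hp 1 (by decide)) ?_ ?_ (hy 0) (hy 1)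
    · rw [mul_conj_swap (hw.orth 0 1), conj_mul_swap (by simp [hc]), h₁]; simp
    · rw [mul_conj_mul_self, hw.null, zero_smul]
  have hB : mul (Triality.conj c) (mul (w 1) u₁) ∈ LinearMap.ker (mul.flip y) := by
    refine mul_eq_zero_of_pair (hp 2 (by decide)) ?_ ?_ (hy 0) (hy 2)
    · rw [mul_conj_swap (by simp [hc]), conj_mul_swap (hw.orth 0 1), h₁]; simp
    · rw [mul_conj_swap (by simp [hc]), conj_mul_swap (hw.orth 2 1), ← h, conj_mul_mul_self,
        hw.null]
      simp
  have := add_mem hA hB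
  rwa [hdec] at this

/-! ## Lifts of smooth maps to a projective space -/

section Lifts

variable {V : Type*} [NormedAddCommGroup V] [NormedSpace ℝ V]

lemma fderiv_collinear {E : Type*} [NormedAddCommGroup E] [NormedSpace ℝ E] {g g' : E → V} {x : E}
    (hg : DifferentiableAt ℝ g x) (hg' : DifferentiableAt ℝ g' x) (hx : g x ≠ 0)
    (h : ∀ᶠ y in 𝓝 x, ∃ s : ℝ, g' y = s • g y) {r : ℝ} (hr : g' x = r • g x) (X : E) :
    ∃ t : ℝ, fderiv ℝ g' x X = r • fderiv ℝ g x X + t • g x := by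
  obtain ⟨ℓ, hℓ⟩ := SeparatingDual.exists_eq_one (R := ℝ) hx
  -- The factor `s` is not known to be differentiable; a functional equal to 1 on `g x` eliminates
  -- it before differentiation.
  have heq : (fun y => ℓ (g y) • g' y) =ᶠ[𝓝 x] fun y => ℓ (g' y) • g y := by
    filter_upwards [h] with y ⟨s, hs⟩
    rw [hs, map_smul, smul_smul, smul_eq_mul, mul_comm]
  have h1 := (ℓ.hasFDerivAt.comp x hg.hasFDerivAt).smul hg'.hasFDerivAt
  have h2 := (ℓ.hasFDerivAt.comp x hg'.hasFDerivAt).smul hg.hasFDerivAt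
  have h3 := h1.unique (h2.congr_of_eventuallyEq heq)
  have h4 := congrArg (fun L => L X) h3
  simp only [Function.comp_apply, hℓ, hr, map_smul, _root_.add_apply,
    _root_.smul_apply, ContinuousLinearMap.smulRight_apply,
    ContinuousLinearMap.comp_apply, smul_eq_mul, one_smul, mul_one] at h4
  refine ⟨ℓ (fderiv ℝ g' x X) - ℓ (fderiv ℝ g x X) * r, ?_⟩
  rw [sub_smul, mul_smul, ← add_sub_assoc, ← h4]
  abel

variable {S : Type*} [TopologicalSpace S] [ChartedSpace (EuclideanSpace ℝ (Fin 2)) S]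

/-- The tangent map of a vector valued function on a surface. -/
noncomputable def dmap (ψ : S → V) (p : S) : EuclideanSpace ℝ (Fin 2) →L[ℝ] V :=
  mfderiv (𝓡 2) 𝓘(ℝ, V) ψ p

lemma writtenInExtChartAt_vectorSpace (ψ : S → V) (p : S) :
    writtenInExtChartAt (𝓡 2) 𝓘(ℝ, V) p ψ = ψ ∘ (extChartAt (𝓡 2) p).symm := rfl

lemma dmap_eq_fderiv_chart {ψ : S → V} {p : S} (h : MDifferentiableAt (𝓡 2) 𝓘(ℝ, V) ψ p) :
    dmap ψ p = fderiv ℝ (ψ ∘ (extChartAt (𝓡 2) p).symm) (extChartAt (𝓡 2) p p) := by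
  refine h.mfderiv.trans ?_
  rw [writtenInExtChartAt_vectorSpace, ModelWithCorners.range_eq_univ, fderivWithin_univ]

lemma differentiableAt_chart {ψ : S → V} {p : S} (h : MDifferentiableAt (𝓡 2) 𝓘(ℝ, V) ψ p) :
    DifferentiableAt ℝ (ψ ∘ (extChartAt (𝓡 2) p).symm) (extChartAt (𝓡 2) p p) := by
  have := h.differentiableWithinAt_writtenInExtChartAt
  rwa [writtenInExtChartAt_vectorSpace, ModelWithCorners.range_eq_univ,
    differentiableWithinAt_univ] at this

variable {φ : S → ℙ ℝ V} {p : S} {ψ : S → V}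

lemma IsLocalLift.mdifferentiableAt (h : IsLocalLift φ p ψ) :
    MDifferentiableAt (𝓡 2) 𝓘(ℝ, V) ψ p := by
  obtain ⟨U, hU, hp, hψ, -⟩ := h
  exact (hψ.contMDiffAt (hU.mem_nhds hp)).mdifferentiableAt (by simp)

lemma IsLocalLift.ne_zero (h : IsLocalLift φ p ψ) : ψ p ≠ 0 := by
  obtain ⟨U, hU, hp, hψ, h⟩ := h
  exact (h p hp).1

lemma IsLocalLift.submodule_eq (h : IsLocalLift φ p ψ) :
    (φ p).submodule = Submodule.span ℝ {ψ p} := by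
  obtain ⟨U, hU, hp, hψ, h⟩ := h
  obtain ⟨h0, h1⟩ := h p hp
  rw [← h1, Projectivization.submodule_mk]

lemma IsLocalLift.mem (h : IsLocalLift φ p ψ) : ψ p ∈ (φ p).submodule := by
  rw [h.submodule_eq]
  exact Submodule.mem_span_singleton_self _

lemma IsLocalLift.exists_eq_smul (h : IsLocalLift φ p ψ) (w : (φ p).submodule) :
    ∃ r : ℝ, w = r • ⟨ψ p, h.mem⟩ := by
  obtain ⟨r, hr⟩ := Submodule.mem_span_singleton.1 (h.submodule_eq.le w.2)
  exact ⟨r, Subtype.ext hr.symm⟩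

lemma IsLocalLift.dmap_collinear {ψ' : S → V} (h : IsLocalLift φ p ψ)
    (h' : IsLocalLift φ p ψ') {r : ℝ} (hr : ψ' p = r • ψ p) (X : EuclideanSpace ℝ (Fin 2)) :
    ∃ t : ℝ, dmap ψ' p X =
      r • dmap ψ p X + t • ψ p := by
  rw [dmap_eq_fderiv_chart h.mdifferentiableAt, dmap_eq_fderiv_chart h'.mdifferentiableAt]
  have hp : (extChartAt (𝓡 2) p).symm (extChartAt (𝓡 2) p p) = p := extChartAt_to_inv p
  have hd := differentiableAt_chart h.mdifferentiableAt
  have hd' := differentiableAt_chart h'.mdifferentiableAt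
  have h0 := h.ne_zero
  obtain ⟨U, hU, hpU, -, hl⟩ := h
  obtain ⟨U', hU', hpU', -, hl'⟩ := h'
  have hev : ∀ᶠ y in 𝓝 (extChartAt (𝓡 2) p p), (extChartAt (𝓡 2) p).symm y ∈ U ∩ U' := by
    refine (continuousAt_extChartAt_symm p).eventually_mem ?_
    rw [hp]
    exact (hU.inter hU').mem_nhds ⟨hpU, hpU'⟩
  have := fderiv_collinear (r := r) hd hd' (by simpa [hp] using h0) ?_ (by simpa [hp] using hr) X
  · simpa [hp] using this
  · filter_upwards [hev] with y hy
    obtain ⟨a, ha⟩ := hl _ hy.1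
    obtain ⟨b, hb⟩ := hl' _ hy.2
    obtain ⟨s, hs⟩ := (Projectivization.mk_eq_mk_iff' ℝ _ _ b a).1 (hb.trans ha.symm)
    exact ⟨s, hs.symm⟩

lemma IsLocalLift.hasTangentMap_tangentMap (h : IsLocalLift φ p ψ) :
    HasTangentMap φ p (tangentMap φ p) := by
  have hex : ∃ D, HasTangentMap φ p D := by
    obtain ⟨ℓ, hℓ⟩ := SeparatingDual.exists_eq_one (R := ℝ) h.ne_zero
    refine ⟨(LinearMap.smulRightₗ (ℓ.toLinearMap.domRestrict (φ p).submodule)) ∘ₗ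
      (φ p).submodule.mkQ ∘ₗ (dmap ψ p).toLinearMap, ψ, h, fun X w hw => ?_⟩
    change ℓ (w : V) • (φ p).submodule.mkQ (dmap ψ p X) = (φ p).submodule.mkQ (dmap ψ p X)
    rw [hw, hℓ, one_smul]
  rw [tangentMap, dif_pos hex]
  exact hex.choose_spec

/-- The tangent map may be computed with any local lift. -/
lemma IsLocalLift.tangentMap_apply (h : IsLocalLift φ p ψ) (X : EuclideanSpace ℝ (Fin 2))
    (w : (φ p).submodule) (hw : (w : V) = ψ p) :
    tangentMap φ p X w = (φ p).submodule.mkQ (dmap ψ p X) := by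
  obtain ⟨ψ', h', hD⟩ := h.hasTangentMap_tangentMap
  have hm := h'.mem
  rw [h.submodule_eq] at hm
  obtain ⟨r, hr⟩ := Submodule.mem_span_singleton.1 hm
  have hr0 : r ≠ 0 := by
    rintro rfl
    exact h'.ne_zero (by rw [← hr, zero_smul])
  have h1 : tangentMap φ p X (r • w) = (φ p).submodule.mkQ (dmap ψ' p X) := hD X (r • w) (by rw [Submodule.coe_smul, hw, hr])
  obtain ⟨t, ht⟩ := h.dmap_collinear h' hr.symm X
  rw [ht, map_smul, map_add, map_smul, map_smul] at h1
  have h2 : (φ p).submodule.mkQ (ψ p) = 0 := by simpa using h.mem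
  rw [h2, smul_zero, add_zero] at h1
  exact smul_right_injective _ hr0 h1

lemma IsLocalLift.mem_tangentPlane (h : IsLocalLift φ p ψ) {v : V} :
    v ∈ tangentPlane φ p ↔ ∃ (a : ℝ) (X : EuclideanSpace ℝ (Fin 2)),
      v = a • ψ p + dmap ψ p X := by
  have hkey : (⨆ X, LinearMap.range (tangentMap φ p X)) =
      (LinearMap.range (dmap ψ p).toLinearMap).map (φ p).submodule.mkQ := by
    apply le_antisymm
    · refine iSup_le fun X => ?_
      rintro _ ⟨w, rfl⟩
      obtain ⟨r, hw'⟩ := h.exists_eq_smul w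
      rw [hw', map_smul, h.tangentMap_apply X ⟨ψ p, h.mem⟩ rfl, ← map_smul]
      exact Submodule.mem_map_of_mem (Submodule.smul_mem _ _ ⟨X, rfl⟩)
    · rintro _ ⟨_, ⟨X, rfl⟩, rfl⟩
      refine Submodule.mem_iSup_of_mem X ⟨⟨ψ p, h.mem⟩, ?_⟩
      rw [h.tangentMap_apply X ⟨ψ p, h.mem⟩ rfl]
      rfl
  rw [tangentPlane, hkey, Submodule.comap_map_eq, Submodule.ker_mkQ, h.submodule_eq,
    Submodule.mem_sup]
  constructor
  · rintro ⟨_, ⟨X, rfl⟩, z, hz, rfl⟩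
    obtain ⟨a, rfl⟩ := Submodule.mem_span_singleton.1 hz
    exact ⟨a, X, add_comm _ _⟩
  · rintro ⟨a, X, rfl⟩
    exact ⟨_, ⟨X, rfl⟩, a • ψ p, Submodule.mem_span_singleton.2 ⟨a, rfl⟩, add_comm _ _⟩

lemma IsLocalLift.eq_zero_of_injective (h : IsLocalLift φ p ψ)
    (hi : Function.Injective (tangentMap φ p)) {a : ℝ} {X : EuclideanSpace ℝ (Fin 2)}
    (h0 : a • ψ p + dmap ψ p X = 0) : a = 0 ∧ X = 0 := by
  have hX : X = 0 := by
    refine hi (Eq.trans ?_ (map_zero (tangentMap φ p)).symm)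
    ext w : 1
    obtain ⟨r, hw'⟩ := h.exists_eq_smul w
    have hm : dmap ψ p X ∈ (φ p).submodule := by
      rw [eq_neg_of_add_eq_zero_right h0]
      exact neg_mem (Submodule.smul_mem _ _ h.mem)
    rw [hw', map_smul, h.tangentMap_apply X ⟨ψ p, h.mem⟩ rfl]
    have : (φ p).submodule.mkQ (dmap ψ p X) = 0 := by
      simpa using hm
    rw [this]
    simp
  refine ⟨?_, hX⟩
  rw [hX, map_zero] at h0
  have h1 : a • ψ p = 0 := by rw [← h0]; exact (add_zero _).symm
  exact (smul_eq_zero.1 h1).resolve_right h.ne_zero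

/-- `f` is a smooth nowhere zero lift of `φ`, read in the chart at `p` on the open set `Ω`. -/
structure IsChartLift (φ : S → ℙ ℝ V) (p : S) (Ω : Set (EuclideanSpace ℝ (Fin 2)))
    (f : EuclideanSpace ℝ (Fin 2) → V) : Prop where
  isOpen : IsOpen Ω
  mem : extChartAt (𝓡 2) p p ∈ Ω
  subset : Ω ⊆ (extChartAt (𝓡 2) p).target
  contDiffOn : ContDiffOn ℝ ∞ f Ω
  lift : ∀ x ∈ Ω, ∃ h : f x ≠ 0, Projectivization.mk ℝ (f x) h = φ ((extChartAt (𝓡 2) p).symm x)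

variable {Ω : Set (EuclideanSpace ℝ (Fin 2))} {f : EuclideanSpace ℝ (Fin 2) → V}

lemma IsChartLift.mono (h : IsChartLift φ p Ω f) {Ω' : Set (EuclideanSpace ℝ (Fin 2))}
    (ho : IsOpen Ω') (hp : extChartAt (𝓡 2) p p ∈ Ω') (hs : Ω' ⊆ Ω) : IsChartLift φ p Ω' f :=
  ⟨ho, hp, hs.trans h.subset, h.contDiffOn.mono hs, fun x hx => h.lift x (hs hx)⟩

lemma IsChartLift.differentiableAt (h : IsChartLift φ p Ω f) {x : EuclideanSpace ℝ (Fin 2)}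
    (hx : x ∈ Ω) : DifferentiableAt ℝ f x :=
  (h.contDiffOn.contDiffAt (h.isOpen.mem_nhds hx)).differentiableAt (by simp)

lemma IsChartLift.contDiffOn_fderiv (h : IsChartLift φ p Ω f) :
    ContDiffOn ℝ ∞ (fderiv ℝ f) Ω :=
  h.contDiffOn.fderiv_of_isOpen h.isOpen (by simp)

variable [IsManifold (𝓡 2) ∞ S]

lemma IsLocalLift.exists_isChartLift (h : IsLocalLift φ p ψ) :
    ∃ Ω, IsChartLift φ p Ω (ψ ∘ (extChartAt (𝓡 2) p).symm) := by
  obtain ⟨U, hU, hp, hψ, hl⟩ := h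
  refine ⟨(extChartAt (𝓡 2) p).target ∩ (extChartAt (𝓡 2) p).symm ⁻¹' U, ?_, ?_,
    Set.inter_subset_left, ?_, fun x hx => hl _ hx.2⟩
  · exact (continuousOn_extChartAt_symm p).isOpen_inter_preimage (isOpen_extChartAt_target p) hU
  · exact ⟨mem_extChartAt_target p, by simpa using hp⟩
  · rw [← contMDiffOn_iff_contDiffOn]
    exact hψ.comp ((contMDiffOn_extChartAt_symm p).mono Set.inter_subset_left)
      fun x hx => hx.2

lemma IsChartLift.isLocalLift (h : IsChartLift φ p Ω f) {x : EuclideanSpace ℝ (Fin 2)}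
    (hx : x ∈ Ω) :
    IsLocalLift φ ((extChartAt (𝓡 2) p).symm x) (f ∘ extChartAt (𝓡 2) p) := by
  refine ⟨(extChartAt (𝓡 2) p).source ∩ extChartAt (𝓡 2) p ⁻¹' Ω, ?_, ?_, ?_, fun q hq => ?_⟩
  · exact (continuousOn_extChartAt p).isOpen_inter_preimage (isOpen_extChartAt_source p) h.isOpen
  · refine ⟨(extChartAt (𝓡 2) p).map_target (h.subset hx), ?_⟩
    rw [Set.mem_preimage, (extChartAt (𝓡 2) p).right_inv (h.subset hx)]
    exact hx
  · refine (contMDiffOn_iff_contDiffOn.2 h.contDiffOn).comp (t := Ω) ?_ fun q hq => hq.2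
    have := contMDiffOn_extChartAt (I := 𝓡 2) (n := ∞) (x := p)
    rw [← extChartAt_source (𝓡 2)] at this
    exact this.mono Set.inter_subset_left
  · obtain ⟨h0, h1⟩ := h.lift _ hq.2
    refine ⟨h0, ?_⟩
    rw [(extChartAt (𝓡 2) p).left_inv hq.1] at h1
    exact h1

lemma IsChartLift.isLocalLift_self (h : IsChartLift φ p Ω f) :
    IsLocalLift φ p (f ∘ extChartAt (𝓡 2) p) := by
  have := h.isLocalLift h.mem
  rwa [extChartAt_to_inv] at this

lemma IsChartLift.dmap_self (h : IsChartLift φ p Ω f) :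
    dmap (f ∘ extChartAt (𝓡 2) p) p = fderiv ℝ f (extChartAt (𝓡 2) p p) := by
  rw [dmap_eq_fderiv_chart h.isLocalLift_self.mdifferentiableAt]
  refine Filter.EventuallyEq.fderiv_eq ?_
  filter_upwards [h.isOpen.mem_nhds h.mem] with x hx
  simp only [Function.comp_apply]
  rw [(extChartAt (𝓡 2) p).right_inv (h.subset hx)]

lemma IsChartLift.tangentMap_apply (h : IsChartLift φ p Ω f) (X : EuclideanSpace ℝ (Fin 2))
    (w : (φ p).submodule) (hw : (w : V) = f (extChartAt (𝓡 2) p p)) :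
    tangentMap φ p X w = (φ p).submodule.mkQ (fderiv ℝ f (extChartAt (𝓡 2) p p) X) := by
  rw [h.isLocalLift_self.tangentMap_apply X w hw, h.dmap_self]

/-- Away from `p`, the manifold derivative uses another preferred chart. The invertible derivative
of the chart at `p` relates it to `fderiv`, preserving images and injectivity. -/
lemma IsChartLift.exists_dmap_eq (h : IsChartLift φ p Ω f) {x : EuclideanSpace ℝ (Fin 2)}
    (hx : x ∈ Ω) : ∃ A : EuclideanSpace ℝ (Fin 2) ≃
        EuclideanSpace ℝ (Fin 2), A 0 = 0 ∧ ∀ X,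
      dmap (f ∘ extChartAt (𝓡 2) p) ((extChartAt (𝓡 2) p).symm x) X =
        fderiv ℝ f x (A X) := by
  have : IsManifold (𝓡 2) 1 S := IsManifold.of_le (n := ∞) (by simp)
  have hq := (extChartAt (𝓡 2) p).map_target (h.subset hx)
  have hqx := (extChartAt (𝓡 2) p).right_inv (h.subset hx)
  obtain ⟨A, hA⟩ := isInvertible_mfderiv_extChartAt (I := 𝓡 2) hq
  refine ⟨A.toEquiv, A.map_zero, fun X => ?_⟩
  have hf : MDifferentiableAt 𝓘(ℝ, EuclideanSpace ℝ (Fin 2)) 𝓘(ℝ, V) f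
      (extChartAt (𝓡 2) p ((extChartAt (𝓡 2) p).symm x)) := by
    rw [hqx]
    exact (h.differentiableAt hx).mdifferentiableAt
  have hc := mfderiv_comp _ hf (mdifferentiableAt_extChartAt (I := 𝓡 2) (by simpa using hq))
  change (mfderiv (𝓡 2) 𝓘(ℝ, V) (f ∘ extChartAt (𝓡 2) p) _ : _) X = _
  rw [hc, ← hA, mfderiv_eq_fderiv, hqx]
  rfl

lemma IsChartLift.mem_tangentPlane (h : IsChartLift φ p Ω f) {x : EuclideanSpace ℝ (Fin 2)}
    (hx : x ∈ Ω) {v : V} : v ∈ tangentPlane φ ((extChartAt (𝓡 2) p).symm x) ↔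
      ∃ (a : ℝ) (X : EuclideanSpace ℝ (Fin 2)), v = a • f x + fderiv ℝ f x X := by
  have hqx := (extChartAt (𝓡 2) p).right_inv (h.subset hx)
  obtain ⟨A, -, hA⟩ := h.exists_dmap_eq hx
  rw [(h.isLocalLift hx).mem_tangentPlane]
  constructor
  · rintro ⟨a, X, rfl⟩
    refine ⟨a, A X, ?_⟩
    rw [hA, Function.comp_apply, hqx]
  · rintro ⟨a, X, rfl⟩
    refine ⟨a, A.symm X, ?_⟩
    rw [hA, Function.comp_apply, hqx, A.apply_symm_apply]

lemma IsChartLift.eq_zero_of_injective (h : IsChartLift φ p Ω f)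
    {x : EuclideanSpace ℝ (Fin 2)} (hx : x ∈ Ω)
    (hi : Function.Injective (tangentMap φ ((extChartAt (𝓡 2) p).symm x))) {a : ℝ}
    {X : EuclideanSpace ℝ (Fin 2)} (h0 : a • f x + fderiv ℝ f x X = 0) : a = 0 ∧ X = 0 := by
  have hqx := (extChartAt (𝓡 2) p).right_inv (h.subset hx)
  obtain ⟨A, hA0, hA⟩ := h.exists_dmap_eq hx
  have := (h.isLocalLift hx).eq_zero_of_injective hi (a := a) (X := A.symm X) (by
    rw [hA, Function.comp_apply, hqx, A.apply_symm_apply, h0])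
  refine ⟨this.1, ?_⟩
  rw [← A.apply_symm_apply X, this.2, hA0]

end Lifts

/-! ## The incidence variety and its distribution -/

lemma mem_kerR {l : ℙ ℝ Zorn} {v : Zorn} : v ∈ kerR l ↔ ∀ z ∈ l.submodule, mul v z = 0 := by
  simp only [kerR, Submodule.mem_iInf, LinearMap.mem_ker, LinearMap.flip_apply]
  exact ⟨fun h z hz => h ⟨z, hz⟩, fun h z => h z z.2⟩

lemma mem_kerL {l : ℙ ℝ Zorn} {v : Zorn} : v ∈ kerL l ↔ ∀ z ∈ l.submodule, mul z v = 0 := by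
  simp only [kerL, Submodule.mem_iInf, LinearMap.mem_ker]
  exact ⟨fun h z hz => h ⟨z, hz⟩, fun h z => h z z.2⟩

lemma mem_kerR_mk {z v : Zorn} (hz : z ≠ 0) :
    v ∈ kerR (Projectivization.mk ℝ z hz) ↔ mul v z = 0 := by
  rw [mem_kerR, Projectivization.submodule_mk]
  refine ⟨fun h => h z (Submodule.mem_span_singleton_self z), fun h w hw => ?_⟩
  obtain ⟨r, rfl⟩ := Submodule.mem_span_singleton.1 hw
  rw [map_smul, h, smul_zero]

lemma mem_kerL_mk {z v : Zorn} (hz : z ≠ 0) :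
    v ∈ kerL (Projectivization.mk ℝ z hz) ↔ mul z v = 0 := by
  rw [mem_kerL, Projectivization.submodule_mk]
  refine ⟨fun h => h z (Submodule.mem_span_singleton_self z), fun h w hw => ?_⟩
  obtain ⟨r, rfl⟩ := Submodule.mem_span_singleton.1 hw
  rw [map_smul, LinearMap.smul_apply, h, smul_zero]

lemma mk_mem_quadric {z : Zorn} (hz : z ≠ 0) :
    Projectivization.mk ℝ z hz ∈ Quadric ↔ N z = 0 := by
  rw [Quadric, Set.mem_ofPred_eq, Projectivization.submodule_mk]
  refine ⟨fun h => h z (Submodule.mem_span_singleton_self z), fun h w hw => ?_⟩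
  obtain ⟨r, rfl⟩ := Submodule.mem_span_singleton.1 hw
  rw [N_smul, h, mul_zero]

lemma N_eq_zero_of_mem_kerR {l : ℙ ℝ Zorn} {v : Zorn} (h : v ∈ kerR l) : N v = 0 := by
  induction l using Projectivization.ind with
  | h z hz => exact N_left_eq_zero hz ((mem_kerR_mk hz).1 h)

lemma mk_mem_incidence {c : Fin 3 → Zorn} (hc : ∀ i, c i ≠ 0) :
    (fun i => Projectivization.mk ℝ (c i) (hc i)) ∈ Incidence ↔
      ∀ i, mul (c i) (c (i + 1)) = 0 := by
  have hiff : ∀ i, (∀ u ∈ (Projectivization.mk ℝ (c i) (hc i)).submodule,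
      ∀ w ∈ (Projectivization.mk ℝ (c (i + 1)) (hc (i + 1))).submodule, mul u w = 0) ↔
      mul (c i) (c (i + 1)) = 0 := fun i => by
    simp only [← mem_kerR, mem_kerR_mk]
    rw [Projectivization.submodule_mk]
    refine ⟨fun h => h _ (Submodule.mem_span_singleton_self _), fun h w hw => ?_⟩
    obtain ⟨r, rfl⟩ := Submodule.mem_span_singleton.1 hw
    rw [map_smul, LinearMap.smul_apply, h, smul_zero]
  simp only [Incidence, Set.mem_ofPred_eq, hiff, mk_mem_quadric]
  exact ⟨fun h => h.2, fun h => ⟨fun i => N_left_eq_zero (hc (i + 1)) (h i), h⟩⟩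

/-- The vectors along which the `i`-th line of a flag may be moved, the two others being fixed. -/
noncomputable def fiberSpace (x : Fin 3 → ℙ ℝ Zorn) (i : Fin 3) : Submodule ℝ Zorn :=
  kerR (x (i + 1)) ⊓ kerL (x (i - 1))

lemma submodule_le_fiberSpace {x : Fin 3 → ℙ ℝ Zorn} (hx : x ∈ Incidence) (i : Fin 3) :
    (x i).submodule ≤ fiberSpace x i := fun u hu =>
  ⟨mem_kerR.2 fun w hw => hx.2 i u hu w hw,
    mem_kerL.2 fun w hw => hx.2 (i - 1) w hw u (by rwa [sub_add_cancel])⟩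

lemma mkQ_mem_map_fiberSpace {x : Fin 3 → ℙ ℝ Zorn} (hx : x ∈ Incidence) {i : Fin 3} {v : Zorn} :
    (x i).submodule.mkQ v ∈ (fiberSpace x i).map (x i).submodule.mkQ ↔ v ∈ fiberSpace x i := by
  rw [← Submodule.mem_comap, Submodule.comap_map_eq, Submodule.ker_mkQ,
    sup_eq_left.2 (submodule_le_fiberSpace hx i)]

lemma fderiv_mul_eq_zero {E : Type*} [NormedAddCommGroup E] [NormedSpace ℝ E] {f g : E → Zorn}
    {x : E} (hf : DifferentiableAt ℝ f x) (hg : DifferentiableAt ℝ g x)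
    (h : ∀ᶠ y in 𝓝 x, mul (f y) (g y) = 0) (X : E) :
    mul (f x) (fderiv ℝ g x X) + mul (fderiv ℝ f x X) (g x) = 0 := by
  have h1 := mul.toContinuousBilinearMap.hasFDerivAt_of_bilinear hf.hasFDerivAt hg.hasFDerivAt
  have h2 : HasFDerivAt (fun y => mul.toContinuousBilinearMap (f y) (g y)) (0 : E →L[ℝ] Zorn) x :=
    (hasFDerivAt_const (0 : Zorn) x).congr_of_eventuallyEq h
  exact congrArg (fun L => L X) (h1.unique h2)

/-- The linearized incidence relation on tangent vectors. -/
lemma mul_add_mul_of_mem_tangentIncidence {x : Fin 3 → ℙ ℝ Zorn} (hx : x ∈ Incidence)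
    {v : TProd x} (hv : v ∈ tangentIncidence x) (i j : Fin 3) (hij : j = i + 1)
    (w : (x i).submodule) (w' : (x j).submodule) (u u' : Zorn)
    (hu : v i w = (x i).submodule.mkQ u) (hu' : v j w' = (x j).submodule.mkQ u') :
    mul u w' + mul (w : Zorn) u' = 0 := by
  subst hij
  have hinc : ∀ a ∈ (x i).submodule, ∀ b ∈ (x (i + 1)).submodule, mul a b = 0 := hx.2 i
  have hsub : ∀ (k : Fin 3) (a b : Zorn), (x k).submodule.mkQ a = (x k).submodule.mkQ b →
      a - b ∈ (x k).submodule := fun k a b h => (Submodule.Quotient.eq _).1 h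
  -- Incidence makes the expression depend only on classes modulo the lines, so representatives may
  -- be chosen freely in the induction.
  have hcong : ∀ a b a' b', (x i).submodule.mkQ a = (x i).submodule.mkQ a' →
      (x (i + 1)).submodule.mkQ b = (x (i + 1)).submodule.mkQ b' →
      mul a w' + mul (w : Zorn) b = mul a' w' + mul (w : Zorn) b' := by
    intro a b a' b' ha hb
    have h1 := hinc _ (hsub _ _ _ ha) w' w'.2
    have h2 := hinc w w.2 _ (hsub _ _ _ hb)
    rw [map_sub, LinearMap.sub_apply, sub_eq_zero] at h1
    rw [map_sub, sub_eq_zero] at h2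
    rw [h1, h2]
  induction hv using Submodule.span_induction generalizing u u' with
  | mem v hv =>
    obtain ⟨c, hc, hcI, hc0⟩ := hv
    obtain ⟨hne, -⟩ := hcI.self_of_nhds
    have hev : ∀ᶠ t in 𝓝 (0 : ℝ), mul (c i t) (c (i + 1) t) = 0 := by
      filter_upwards [hcI] with t ⟨ht, hI⟩
      exact (mk_mem_incidence ht).1 hI i
    have hd : ∀ k, DifferentiableAt ℝ (c k) 0 := fun k => (hc k).differentiable (by simp) 0
    have hprod := fderiv_mul_eq_zero (hd i) (hd (i + 1)) hev 1
    rw [fderiv_apply_one_eq_deriv, fderiv_apply_one_eq_deriv] at hprod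
    have hline : ∀ (k : Fin 3) (a : (x k).submodule), ∃ r : ℝ, a = r • ⟨c k 0, (hc0 k).1⟩ := by
      intro k a
      have hspan : (x k).submodule = Submodule.span ℝ {c k 0} := by
        have := (hc0 k).1
        revert this
        induction x k using Projectivization.ind with
        | h z hz =>
          rw [Projectivization.submodule_mk]
          intro h
          obtain ⟨r, hr⟩ := Submodule.mem_span_singleton.1 h
          have hr0 : IsUnit r := by
            refine isUnit_iff_ne_zero.2 ?_
            rintro rfl
            exact hne k (by rw [← hr, zero_smul])
          rw [← hr, Submodule.span_singleton_smul_eq hr0]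
      obtain ⟨r, hr⟩ := Submodule.mem_span_singleton.1 (hspan.le a.2)
      exact ⟨r, Subtype.ext hr.symm⟩
    obtain ⟨r, rfl⟩ := hline _ w
    obtain ⟨s, rfl⟩ := hline _ w'
    rw [hcong u u' (r • deriv (c i) 0) (s • deriv (c (i + 1)) 0)]
    · simp only [Submodule.coe_smul, map_smul, LinearMap.smul_apply]
      rw [← smul_add, ← smul_add, add_comm, hprod, smul_zero, smul_zero]
    · rw [← hu, map_smul, map_smul, (hc0 i).2 _ rfl]
    · rw [← hu', map_smul, map_smul, (hc0 (i + 1)).2 _ rfl]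
  | zero =>
    rw [hcong u u' 0 0 (hu.symm.trans (map_zero _).symm) (hu'.symm.trans (map_zero _).symm)]
    simp
  | add v₁ v₂ _ _ h₁ h₂ =>
    obtain ⟨a, ha⟩ := Submodule.mkQ_surjective _ (v₁ i w)
    obtain ⟨b, hb⟩ := Submodule.mkQ_surjective _ (v₁ (i + 1) w')
    obtain ⟨a', ha'⟩ := Submodule.mkQ_surjective _ (v₂ i w)
    obtain ⟨b', hb'⟩ := Submodule.mkQ_surjective _ (v₂ (i + 1) w')
    rw [hcong u u' (a + a') (b + b') (by rw [← hu, map_add, ha, ha']; rfl)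
      (by rw [← hu', map_add, hb, hb']; rfl), map_add, map_add, LinearMap.add_apply,
      add_add_add_comm, h₁ a b ha.symm hb.symm, h₂ a' b' ha'.symm hb'.symm, add_zero]
  | smul r v _ h =>
    obtain ⟨a, ha⟩ := Submodule.mkQ_surjective _ (v i w)
    obtain ⟨b, hb⟩ := Submodule.mkQ_surjective _ (v (i + 1) w')
    rw [hcong u u' (r • a) (r • b) (by rw [← hu, map_smul, ha]; rfl)
      (by rw [← hu', map_smul, hb]; rfl), map_smul, map_smul, LinearMap.smul_apply,
      ← smul_add, h a b ha.symm hb.symm, smul_zero]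

lemma mem_map_fiberSpace_of_mem_xi {x : Fin 3 → ℙ ℝ Zorn} (hx : x ∈ Incidence) {v : TProd x}
    (hv : v ∈ xi x) (i : Fin 3) (w : (x i).submodule) :
    v i w ∈ (fiberSpace x i).map (x i).submodule.mkQ := by
  let A : Submodule ℝ (TProd x) :=
    { carrier := {v | ∀ i (w : (x i).submodule), v i w ∈ (fiberSpace x i).map (x i).submodule.mkQ}
      add_mem' := fun h h' i w => add_mem (h i w) (h' i w)
      zero_mem' := fun i w => zero_mem _
      smul_mem' := fun c v h i w => Submodule.smul_mem _ c (h i w) }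
  suffices h : xi x ≤ A from h hv i w
  refine iSup_le fun i v hv j w => ?_
  obtain ⟨⟨hT, h1⟩, h2⟩ := hv
  have h1' : v (i + 1) = 0 := h1
  have h2' : v (i - 1) = 0 := h2
  by_cases hj : j = i
  · subst hj
    obtain ⟨u, hu⟩ := Submodule.mkQ_surjective _ (v j w)
    refine ⟨u, ⟨mem_kerR.2 fun a ha => ?_, mem_kerL.2 fun b hb => ?_⟩, hu⟩
    · have := mul_add_mul_of_mem_tangentIncidence hx hT j (j + 1) rfl w ⟨a, ha⟩ u 0 hu.symm
        (by rw [h1', map_zero]; rfl)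
      simpa using this
    · have := mul_add_mul_of_mem_tangentIncidence hx hT (j - 1) j (by simp) ⟨b, hb⟩ w 0 u
        (by rw [h2', map_zero]; rfl) hu.symm
      simpa using this
  · have h0 : v j = 0 := by
      have : j = i + 1 ∨ j = i - 1 := by clear * - hj; revert i j; decide
      rcases this with rfl | rfl <;> assumption
    rw [h0]
    exact zero_mem _

/-- Incidence is bilinear: moving one line affinely along a vector annihilated by its neighbours
stays in the incidence variety. Each component of `v` is thus a velocity by itself. -/
lemma mem_xi_of_forall {x : Fin 3 → ℙ ℝ Zorn} (hx : x ∈ Incidence) {v : TProd x}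
    (hv : ∀ i (w : (x i).submodule), v i w ∈ (fiberSpace x i).map (x i).submodule.mkQ) :
    v ∈ xi x := by
  have hsum : v = ∑ i, Pi.single i (v i) := (Finset.univ_sum_single v).symm
  rw [hsum]
  refine sum_mem fun i _ => Submodule.mem_iSup_of_mem i ?_
  refine ⟨⟨?_, ?_⟩, ?_⟩
  rotate_left
  · exact Pi.single_eq_of_ne (by revert i; decide) _
  · exact Pi.single_eq_of_ne (by revert i; decide) _
  refine Submodule.subset_span ?_
  have hmem : ∀ k, (x k).rep ∈ (x k).submodule := fun k =>
    (x k).submodule_eq.ge (Submodule.mem_span_singleton_self _)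
  obtain ⟨u, ⟨huR, huL⟩, hu⟩ := hv i ⟨(x i).rep, hmem i⟩
  let d : Fin 3 → Zorn := Pi.single i u
  have hd1 : ∀ k, mul (d k) (x (k + 1)).rep = 0 := fun k => by
    by_cases hk : k = i
    · subst hk
      simpa [d] using mem_kerR.1 huR _ (hmem _)
    · simp [d, hk]
  have hd2 : ∀ k, mul (x k).rep (d (k + 1)) = 0 := fun k => by
    by_cases hk : k + 1 = i
    · obtain rfl : k = i - 1 := by simp [← hk]
      simpa [d] using mem_kerL.1 huL _ (hmem _)
    · simp [d, hk]
  have hd3 : ∀ k, mul (d k) (d (k + 1)) = 0 := fun k => by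
    by_cases hk : k = i
    · have : k + 1 ≠ i := by subst hk; clear * -; revert k; decide
      simp [d, this]
    · simp [d, hk]
  refine ⟨fun k t => (x k).rep + t • d k, fun k => by fun_prop, ?_, fun k => ⟨?_, fun w hw => ?_⟩⟩
  · have hne : ∀ᶠ t in 𝓝 (0 : ℝ), ∀ k, (x k).rep + t • d k ≠ 0 := by
      rw [Filter.eventually_all]
      intro k
      have hc : ContinuousAt (fun t : ℝ => (x k).rep + t • d k) 0 := by fun_prop
      exact hc.eventually_ne (by simpa using (x k).rep_nonzero)
    filter_upwards [hne] with t ht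
    refine ⟨ht, (mk_mem_incidence ht).2 fun k => ?_⟩
    have h0 : mul (x k).rep (x (k + 1)).rep = 0 := hx.2 k _ (hmem _) _ (hmem _)
    simp [h0, hd1, hd2, hd3]
  · simpa using hmem k
  · have hder : deriv (fun t : ℝ => (x k).rep + t • d k) 0 = d k := by
      have := ((hasDerivAt_id (0 : ℝ)).smul_const (d k)).const_add (x k).rep
      simpa using this.deriv
    rw [hder]
    by_cases hk : k = i
    · subst hk
      have hw' : w = ⟨(x k).rep, hmem k⟩ := Subtype.ext (by simpa using hw)
      rw [hw', Pi.single_eq_same, ← hu]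
      simp [d]
    · simp [d, hk]

/-! ## The Gauss maps of a totally isotropic immersion -/

/-- The moving frame formed by a map of the plane and its partial derivatives. -/
noncomputable def frame (f : EuclideanSpace ℝ (Fin 2) → Zorn) (x : EuclideanSpace ℝ (Fin 2)) :
    Fin 3 → Zorn :=
  ![f x, fderiv ℝ f x (EuclideanSpace.single 0 1), fderiv ℝ f x (EuclideanSpace.single 1 1)]

lemma euclidean_eq_add (X : EuclideanSpace ℝ (Fin 2)) :
    X = X 0 • EuclideanSpace.single 0 (1 : ℝ) + X 1 • EuclideanSpace.single 1 (1 : ℝ) := by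
  ext i
  fin_cases i <;> simp

lemma fderiv_eq_frame (f : EuclideanSpace ℝ (Fin 2) → Zorn) (x X : EuclideanSpace ℝ (Fin 2)) :
    fderiv ℝ f x X = X 0 • frame f x 1 + X 1 • frame f x 2 := by
  conv_lhs => rw [euclidean_eq_add X, map_add, map_smul, map_smul]
  rfl

lemma IsoFrame.swap {w : Fin 3 → Zorn} (hw : IsoFrame w) :
    IsoFrame (w ∘ Equiv.swap 1 2) where
  indep := hw.indep.comp _ (Equiv.injective _)
  null _ := hw.null _
  orth _ _ := hw.orth _ _

variable {S : Type*} [TopologicalSpace S] [ChartedSpace (EuclideanSpace ℝ (Fin 2)) S]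
  {φ : S → ℙ ℝ Zorn} {p : S} {Ω : Set (EuclideanSpace ℝ (Fin 2))}
  {f g h : EuclideanSpace ℝ (Fin 2) → Zorn}

/-! ### Integral surfaces are tangent to the isotropic subspaces -/

lemma IsIntegralSurface.tangentPlane_le {Φ : S → Fin 3 → ℙ ℝ Zorn} (hΦ : IsIntegralSurface Φ)
    (p : S) : tangentPlane (fun q => Φ q 0) p ≤ kerR (Φ p 1) ⊓ kerL (Φ p 2) := by
  obtain ⟨hI, hs, -, hxi⟩ := hΦ
  obtain ⟨ψ, hψ⟩ := hs 0 p
  intro v hv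
  obtain ⟨a, X, rfl⟩ := hψ.mem_tangentPlane.1 hv
  have hX := mem_map_fiberSpace_of_mem_xi (hI p) (hxi p X) 0 ⟨ψ p, hψ.mem⟩
  have hX' : tangentMap (fun q => Φ q 0) p X ⟨ψ p, hψ.mem⟩ ∈
      (fiberSpace (Φ p) 0).map (Φ p 0).submodule.mkQ := hX
  rw [hψ.tangentMap_apply X ⟨ψ p, hψ.mem⟩ rfl, mkQ_mem_map_fiberSpace (hI p)] at hX'
  exact add_mem (Submodule.smul_mem _ a (submodule_le_fiberSpace (hI p) 0 hψ.mem)) hX'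

lemma IsIntegralSurface.isTotallyIsotropicImmersion {Φ : S → Fin 3 → ℙ ℝ Zorn}
    (hΦ : IsIntegralSurface Φ) (h0 : IsImmersion fun p => Φ p 0) :
    IsTotallyIsotropicImmersion fun p => Φ p 0 :=
  ⟨h0, fun p => (hΦ.1 p).1 0, fun p _ hv => N_eq_zero_of_mem_kerR (hΦ.tangentPlane_le p hv).1⟩

/-! ### Moving frames -/

lemma IsChartLift.contDiffOn_frame (h : IsChartLift φ p Ω f) (i : Fin 3) :
    ContDiffOn ℝ ∞ (fun x => frame f x i) Ω := by
  fin_cases i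
  · exact h.contDiffOn
  · exact h.contDiffOn_fderiv.clm_apply contDiffOn_const
  · exact h.contDiffOn_fderiv.clm_apply contDiffOn_const

lemma IsChartLift.of_contDiffOn {φ' : S → ℙ ℝ Zorn} (h : IsChartLift φ p Ω f)
    {g : EuclideanSpace ℝ (Fin 2) → Zorn} (hg : ContDiffOn ℝ ∞ g Ω)
    (h0 : g (extChartAt (𝓡 2) p p) ≠ 0) (hl : ∀ x ∈ Ω, ∀ hx : g x ≠ 0,
      Projectivization.mk ℝ (g x) hx = φ' ((extChartAt (𝓡 2) p).symm x)) :
    ∃ Ω' ⊆ Ω, IsChartLift φ' p Ω' g :=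
  ⟨Ω ∩ g ⁻¹' {0}ᶜ, Set.inter_subset_left,
    hg.continuousOn.isOpen_inter_preimage h.isOpen isOpen_compl_singleton, ⟨h.mem, h0⟩,
    Set.inter_subset_left.trans h.subset, hg.mono Set.inter_subset_left,
    fun x hx => ⟨hx.2, hl x hx.1 hx.2⟩⟩

lemma IsChartLift.mem_kerR (h : IsChartLift φ p Ω f) {v : Zorn} :
    v ∈ kerR (φ p) ↔ mul v (f (extChartAt (𝓡 2) p p)) = 0 := by
  obtain ⟨h0, h1⟩ := h.lift _ h.mem
  rw [extChartAt_to_inv] at h1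
  rw [← h1, mem_kerR_mk]

lemma IsChartLift.mem_kerL (h : IsChartLift φ p Ω f) {v : Zorn} :
    v ∈ kerL (φ p) ↔ mul (f (extChartAt (𝓡 2) p p)) v = 0 := by
  obtain ⟨h0, h1⟩ := h.lift _ h.mem
  rw [extChartAt_to_inv] at h1
  rw [← h1, mem_kerL_mk]

/-- Lifts of `φ`, `φ₋` and `φ₊` in the chart at `p`. -/
structure IsTripleLift (φ : S → ℙ ℝ Zorn) (p : S) (Ω : Set (EuclideanSpace ℝ (Fin 2)))
    (f g h : EuclideanSpace ℝ (Fin 2) → Zorn) : Prop where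
  base : IsChartLift φ p Ω f
  minus : IsChartLift (gaussMinus φ) p Ω g
  plus : IsChartLift (gaussPlus φ) p Ω h

lemma IsTripleLift.eventually (H : IsTripleLift φ p Ω f g h) {x : EuclideanSpace ℝ (Fin 2)}
    (hx : x ∈ Ω) {P : EuclideanSpace ℝ (Fin 2) → Prop} (hP : ∀ y ∈ Ω, P y) : ∀ᶠ y in 𝓝 x, P y := by
  filter_upwards [H.base.isOpen.mem_nhds hx] with y hy using hP y hy

variable [IsManifold (𝓡 2) ∞ S]

lemma IsChartLift.frame_mem (h : IsChartLift φ p Ω f) {x : EuclideanSpace ℝ (Fin 2)} (hx : x ∈ Ω)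
    (i : Fin 3) : frame f x i ∈ tangentPlane φ ((extChartAt (𝓡 2) p).symm x) := by
  rw [h.mem_tangentPlane hx]
  fin_cases i
  · exact ⟨1, 0, by simp [frame]⟩
  · exact ⟨0, EuclideanSpace.single 0 1, by simp [frame]⟩
  · exact ⟨0, EuclideanSpace.single 1 1, by simp [frame]⟩

lemma IsChartLift.tangentPlane_eq (h : IsChartLift φ p Ω f) {x : EuclideanSpace ℝ (Fin 2)}
    (hx : x ∈ Ω) : tangentPlane φ ((extChartAt (𝓡 2) p).symm x) =
      Submodule.span ℝ (Set.range (frame f x)) := by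
  apply le_antisymm
  · intro v hv
    obtain ⟨a, X, rfl⟩ := (h.mem_tangentPlane hx).1 hv
    have hm : ∀ i, frame f x i ∈ Submodule.span ℝ (Set.range (frame f x)) := fun i =>
      Submodule.subset_span ⟨i, rfl⟩
    rw [fderiv_eq_frame]
    exact add_mem (Submodule.smul_mem _ _ (hm 0))
      (add_mem (Submodule.smul_mem _ _ (hm 1)) (Submodule.smul_mem _ _ (hm 2)))
  · rw [Submodule.span_le]
    rintro _ ⟨i, rfl⟩
    exact h.frame_mem hx i

lemma IsChartLift.isoFrame (h : IsChartLift φ p Ω f) (hφ : IsTotallyIsotropicImmersion φ)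
    {x : EuclideanSpace ℝ (Fin 2)} (hx : x ∈ Ω) : IsoFrame (frame f x) := by
  refine IsoFrame.of_span (Fintype.linearIndependent_iff.2 fun g hg => ?_) ?_
  · have h0 := h.eq_zero_of_injective hx (hφ.1.2 _) (a := g 0)
      (X := !₂[g 1, g 2]) (by
        rw [fderiv_eq_frame, ← hg, Fin.sum_univ_three, add_assoc]
        rfl)
    have h1 := congrArg (fun X : EuclideanSpace ℝ (Fin 2) => X 0) h0.2
    have h2 := congrArg (fun X : EuclideanSpace ℝ (Fin 2) => X 1) h0.2
    intro i
    fin_cases i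
    · exact h0.1
    · simpa using h1
    · simpa using h2
  · rw [← h.tangentPlane_eq hx]
    exact hφ.2.2 _

lemma IsChartLift.tangentPlane_le_kerR_mk (h : IsChartLift φ p Ω f)
    {x : EuclideanSpace ℝ (Fin 2)} (hx : x ∈ Ω) {z : Zorn} (hz : z ≠ 0) :
    tangentPlane φ ((extChartAt (𝓡 2) p).symm x) ≤ kerR (Projectivization.mk ℝ z hz) ↔
      ∀ i, mul (frame f x i) z = 0 := by
  rw [h.tangentPlane_eq hx, Submodule.span_le, Set.range_subset_iff]
  exact forall_congr' fun i => mem_kerR_mk hz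

lemma IsChartLift.tangentPlane_le_kerL_mk (h : IsChartLift φ p Ω f)
    {x : EuclideanSpace ℝ (Fin 2)} (hx : x ∈ Ω) {z : Zorn} (hz : z ≠ 0) :
    tangentPlane φ ((extChartAt (𝓡 2) p).symm x) ≤ kerL (Projectivization.mk ℝ z hz) ↔
      ∀ i, mul z (frame f x i) = 0 := by
  rw [h.tangentPlane_eq hx, Submodule.span_le, Set.range_subset_iff]
  exact forall_congr' fun i => mem_kerL_mk hz

lemma IsSmooth.exists_isChartLift (h : IsSmooth φ) (p : S) : ∃ Ω f, IsChartLift φ p Ω f := by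
  obtain ⟨ψ, hψ⟩ := h p
  obtain ⟨Ω, hΩ⟩ := hψ.exists_isChartLift
  exact ⟨Ω, _, hΩ⟩

lemma IsChartLift.isSmooth (h : ∀ p, ∃ Ω f, IsChartLift φ p Ω f) : IsSmooth φ := fun p => by
  obtain ⟨Ω, f, hf⟩ := h p
  exact ⟨_, hf.isLocalLift_self⟩

theorem existsUnique_kerR (hφ : IsTotallyIsotropicImmersion φ) (p : S) :
    ∃! l, l ∈ Quadric ∧ tangentPlane φ p ≤ kerR l := by
  obtain ⟨Ω, f, hf⟩ := hφ.1.1.exists_isChartLift p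
  have hF := hf.isoFrame hφ hf.mem
  obtain ⟨z, hz0, hz, hu⟩ := hF.exists_right
  have hle := fun {w} (hw : w ≠ 0) => hf.tangentPlane_le_kerR_mk hf.mem hw
  rw [extChartAt_to_inv] at hle
  refine ⟨Projectivization.mk ℝ z hz0, ⟨(mk_mem_quadric hz0).2
    (N_right_eq_zero (hF.indep.ne_zero 0) (hz 0)), (hle hz0).2 hz⟩, ?_⟩
  rintro l ⟨-, hl⟩
  induction l using Projectivization.ind with
  | h w hw =>
    obtain ⟨r, hr⟩ := hu w ((hle hw).1 hl)
    exact (Projectivization.mk_eq_mk_iff' ℝ _ _ _ _).2 ⟨r, hr.symm⟩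

theorem existsUnique_kerL (hφ : IsTotallyIsotropicImmersion φ) (p : S) :
    ∃! l, l ∈ Quadric ∧ tangentPlane φ p ≤ kerL l := by
  obtain ⟨Ω, f, hf⟩ := hφ.1.1.exists_isChartLift p
  have hF := hf.isoFrame hφ hf.mem
  obtain ⟨z, hz0, hz, hu⟩ := hF.exists_left
  have hle := fun {w} (hw : w ≠ 0) => hf.tangentPlane_le_kerL_mk hf.mem hw
  rw [extChartAt_to_inv] at hle
  refine ⟨Projectivization.mk ℝ z hz0, ⟨(mk_mem_quadric hz0).2
    (N_left_eq_zero (hF.indep.ne_zero 0) (hz 0)), (hle hz0).2 hz⟩, ?_⟩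
  rintro l ⟨-, hl⟩
  induction l using Projectivization.ind with
  | h w hw =>
    obtain ⟨r, hr⟩ := hu w ((hle hw).1 hl)
    exact (Projectivization.mk_eq_mk_iff' ℝ _ _ _ _).2 ⟨r, hr.symm⟩

lemma gaussMinus_spec (hφ : IsTotallyIsotropicImmersion φ) (p : S) :
    gaussMinus φ p ∈ Quadric ∧ tangentPlane φ p ≤ kerR (gaussMinus φ p) := by
  have h := (existsUnique_kerR hφ p).exists
  rw [gaussMinus, dif_pos h]
  exact h.choose_spec

lemma gaussPlus_spec (hφ : IsTotallyIsotropicImmersion φ) (p : S) :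
    gaussPlus φ p ∈ Quadric ∧ tangentPlane φ p ≤ kerL (gaussPlus φ p) := by
  have h := (existsUnique_kerL hφ p).exists
  rw [gaussPlus, dif_pos h]
  exact h.choose_spec

lemma gaussMinus_eq (hφ : IsTotallyIsotropicImmersion φ) {l : ℙ ℝ Zorn} (hl : l ∈ Quadric)
    (h : tangentPlane φ p ≤ kerR l) : gaussMinus φ p = l :=
  (existsUnique_kerR hφ p).unique (gaussMinus_spec hφ p) ⟨hl, h⟩

lemma gaussPlus_eq (hφ : IsTotallyIsotropicImmersion φ) {l : ℙ ℝ Zorn} (hl : l ∈ Quadric)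
    (h : tangentPlane φ p ≤ kerL l) : gaussPlus φ p = l :=
  (existsUnique_kerL hφ p).unique (gaussPlus_spec hφ p) ⟨hl, h⟩

/-! ### Smoothness of the Gauss maps -/

lemma contDiffOn_mul {E : Type*} [NormedAddCommGroup E] [NormedSpace ℝ E] {s : Set E}
    {g h : E → Zorn} (hg : ContDiffOn ℝ ∞ g s) (hh : ContDiffOn ℝ ∞ h s) :
    ContDiffOn ℝ ∞ (fun x => mul (g x) (h x)) s :=
  (mul.toContinuousBilinearMap.contDiff.comp_contDiffOn hg).clm_apply hh

lemma contDiffOn_conj {E : Type*} [NormedAddCommGroup E] [NormedSpace ℝ E] {s : Set E}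
    {g : E → Zorn} (hg : ContDiffOn ℝ ∞ g s) : ContDiffOn ℝ ∞ (fun x => conj (g x)) s :=
  (LinearMap.toContinuousLinearMap conj).contDiff.comp_contDiffOn hg

lemma contDiffOn_spinor {E : Type*} [NormedAddCommGroup E] [NormedSpace ℝ E] {s : Set E}
    {w : E → Fin 3 → Zorn} (hw : ∀ i, ContDiffOn ℝ ∞ (fun x => w x i) s) (u : Zorn) :
    ContDiffOn ℝ ∞ (fun x => spinor (w x) u) s :=
  contDiffOn_mul (contDiffOn_conj (hw 0))
    (contDiffOn_mul (hw 1) (contDiffOn_mul (contDiffOn_conj (hw 2)) contDiffOn_const))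

/-- The spinor of the moving frame with constant `u` is smooth, annihilated by the tangent plane,
and nonzero near `p`; uniqueness identifies it as a lift. -/
lemma IsChartLift.exists_gaussMinus (h : IsChartLift φ p Ω f)
    (hφ : IsTotallyIsotropicImmersion φ) : ∃ Ω' ⊆ Ω, ∃ g, IsChartLift (gaussMinus φ) p Ω' g := by
  have hF := h.isoFrame hφ h.mem
  obtain ⟨z, hz0, hz, -⟩ := hF.exists_right
  obtain ⟨u, hu⟩ := hF.exists_spinor_eq hz
  obtain ⟨Ω', hΩ, hg⟩ := h.of_contDiffOn (φ' := gaussMinus φ)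
    (contDiffOn_spinor h.contDiffOn_frame u) (by rwa [hu]) fun x hx h0 => by
      have hm := (h.isoFrame hφ hx).mul_spinor u
      exact (gaussMinus_eq hφ ((mk_mem_quadric h0).2
        (N_right_eq_zero ((h.isoFrame hφ hx).indep.ne_zero 0) (hm 0)))
        ((h.tangentPlane_le_kerR_mk hx h0).2 hm)).symm
  exact ⟨Ω', hΩ, _, hg⟩

lemma IsChartLift.exists_gaussPlus (h : IsChartLift φ p Ω f)
    (hφ : IsTotallyIsotropicImmersion φ) : ∃ Ω' ⊆ Ω, ∃ g, IsChartLift (gaussPlus φ) p Ω' g := by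
  have hF := h.isoFrame hφ h.mem
  obtain ⟨z, hz0, hz, -⟩ := hF.conj.exists_right
  obtain ⟨u, hu⟩ := hF.conj.exists_spinor_eq hz
  obtain ⟨Ω', hΩ, hg⟩ := h.of_contDiffOn (φ' := gaussPlus φ)
    (contDiffOn_conj (contDiffOn_spinor (fun i => contDiffOn_conj (h.contDiffOn_frame i)) u))
    (by rwa [hu, Ne, map_eq_zero_iff _ conj_injective]) fun x hx h0 => by
      have hm := fun i => conj_mul_eq_zero_iff.1 ((h.isoFrame hφ hx).conj.mul_spinor u i)
      exact (gaussPlus_eq hφ ((mk_mem_quadric h0).2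
        (N_left_eq_zero ((h.isoFrame hφ hx).indep.ne_zero 0) (hm 0)))
        ((h.tangentPlane_le_kerL_mk hx h0).2 hm)).symm
  exact ⟨Ω', hΩ, _, hg⟩

/-! ### The Gauss maps form an integral surface -/

lemma exists_isTripleLift (hφ : IsTotallyIsotropicImmersion φ) (p : S) :
    ∃ Ω f g h, IsTripleLift φ p Ω f g h := by
  obtain ⟨Ω, f, hf⟩ := hφ.1.1.exists_isChartLift p
  obtain ⟨Ω₁, h₁, g, hg⟩ := hf.exists_gaussMinus hφ
  obtain ⟨Ω₂, h₂, h, hh⟩ := hf.exists_gaussPlus hφ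
  have ho := hg.isOpen.inter hh.isOpen
  have hm := Set.mem_inter hg.mem hh.mem
  exact ⟨Ω₁ ∩ Ω₂, f, g, h, hf.mono ho hm (Set.inter_subset_left.trans h₁),
    hg.mono ho hm Set.inter_subset_left, hh.mono ho hm Set.inter_subset_right⟩

lemma IsTripleLift.frame_mul (H : IsTripleLift φ p Ω f g h) (hφ : IsTotallyIsotropicImmersion φ)
    {x : EuclideanSpace ℝ (Fin 2)} (hx : x ∈ Ω) (i : Fin 3) : mul (frame f x i) (g x) = 0 := by
  obtain ⟨h0, h1⟩ := H.minus.lift x hx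
  have := (gaussMinus_spec hφ ((extChartAt (𝓡 2) p).symm x)).2
  rw [← h1] at this
  exact (H.base.tangentPlane_le_kerR_mk hx h0).1 this i

lemma IsTripleLift.mul_frame (H : IsTripleLift φ p Ω f g h) (hφ : IsTotallyIsotropicImmersion φ)
    {x : EuclideanSpace ℝ (Fin 2)} (hx : x ∈ Ω) (i : Fin 3) : mul (h x) (frame f x i) = 0 := by
  obtain ⟨h0, h1⟩ := H.plus.lift x hx
  have := (gaussPlus_spec hφ ((extChartAt (𝓡 2) p).symm x)).2
  rw [← h1] at this
  exact (H.base.tangentPlane_le_kerL_mk hx h0).1 this i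

lemma IsTripleLift.mul_eq_zero (H : IsTripleLift φ p Ω f g h)
    (hφ : IsTotallyIsotropicImmersion φ) {x : EuclideanSpace ℝ (Fin 2)} (hx : x ∈ Ω) :
    mul (g x) (h x) = 0 :=
  (H.base.isoFrame hφ hx).mul_eq_zero (H.frame_mul hφ hx) (H.mul_frame hφ hx)

lemma gauss_mem_incidence (hφ : IsTotallyIsotropicImmersion φ) (p : S) :
    ![φ p, gaussMinus φ p, gaussPlus φ p] ∈ Incidence := by
  obtain ⟨Ω, f, g, h, H⟩ := exists_isTripleLift hφ p
  obtain ⟨f0, hf⟩ := H.base.lift _ H.base.mem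
  obtain ⟨g0, hg⟩ := H.minus.lift _ H.base.mem
  obtain ⟨h0, hh⟩ := H.plus.lift _ H.base.mem
  rw [extChartAt_to_inv] at hf hg hh
  set x := extChartAt (𝓡 2) p p
  have hx : x ∈ Ω := H.base.mem
  have hne : ∀ i, ![f x, g x, h x] i ≠ 0 := by
    intro i; fin_cases i <;> assumption
  have := (mk_mem_incidence hne).2 (by
    intro i
    fin_cases i
    · exact H.frame_mul hφ hx 0
    · exact H.mul_eq_zero hφ hx
    · exact H.mul_frame hφ hx 0)
  convert this using 1
  ext i : 1
  fin_cases i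
  · exact hf.symm
  · exact hg.symm
  · exact hh.symm

lemma IsTripleLift.fderiv_base_mul (H : IsTripleLift φ p Ω f g h)
    (hφ : IsTotallyIsotropicImmersion φ) {x : EuclideanSpace ℝ (Fin 2)} (hx : x ∈ Ω)
    (X : EuclideanSpace ℝ (Fin 2)) : mul (fderiv ℝ f x X) (g x) = 0 := by
  rw [fderiv_eq_frame]
  simp [H.frame_mul hφ hx]

lemma IsTripleLift.mul_fderiv_base (H : IsTripleLift φ p Ω f g h)
    (hφ : IsTotallyIsotropicImmersion φ) {x : EuclideanSpace ℝ (Fin 2)} (hx : x ∈ Ω)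
    (X : EuclideanSpace ℝ (Fin 2)) : mul (h x) (fderiv ℝ f x X) = 0 := by
  rw [fderiv_eq_frame]
  simp [H.mul_frame hφ hx]

lemma IsTripleLift.mul_fderiv_minus (H : IsTripleLift φ p Ω f g h)
    (hφ : IsTotallyIsotropicImmersion φ) {x : EuclideanSpace ℝ (Fin 2)} (hx : x ∈ Ω)
    (X : EuclideanSpace ℝ (Fin 2)) : mul (f x) (fderiv ℝ g x X) = 0 := by
  have := fderiv_mul_eq_zero (H.base.differentiableAt hx) (H.minus.differentiableAt hx)
    (H.eventually hx fun y hy => H.frame_mul hφ hy 0) X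
  rwa [H.fderiv_base_mul hφ hx, add_zero] at this

lemma IsTripleLift.fderiv_plus_mul (H : IsTripleLift φ p Ω f g h)
    (hφ : IsTotallyIsotropicImmersion φ) {x : EuclideanSpace ℝ (Fin 2)} (hx : x ∈ Ω)
    (X : EuclideanSpace ℝ (Fin 2)) : mul (fderiv ℝ h x X) (f x) = 0 := by
  have := fderiv_mul_eq_zero (H.plus.differentiableAt hx) (H.base.differentiableAt hx)
    (H.eventually hx fun y hy => H.mul_frame hφ hy 0) X
  rwa [H.mul_fderiv_base hφ hx, zero_add] at this

lemma IsTripleLift.mul_fderiv_symm (H : IsTripleLift φ p Ω f g h)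
    (hφ : IsTotallyIsotropicImmersion φ) {x : EuclideanSpace ℝ (Fin 2)} (hx : x ∈ Ω)
    (X Y : EuclideanSpace ℝ (Fin 2)) :
    mul (fderiv ℝ f x X) (fderiv ℝ g x Y) = mul (fderiv ℝ f x Y) (fderiv ℝ g x X) := by
  have hnhds := H.base.isOpen.mem_nhds hx
  have hd : DifferentiableAt ℝ (fderiv ℝ f) x :=
    (H.base.contDiffOn_fderiv.contDiffAt hnhds).differentiableAt (by simp)
  -- Differentiating `df(X) * g = 0` along `Y` expresses the product through the second derivative
  -- of `f`.
  have hkey : ∀ X Y : EuclideanSpace ℝ (Fin 2), mul (fderiv ℝ f x X) (fderiv ℝ g x Y) =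
      - mul (fderiv ℝ (fderiv ℝ f) x Y X) (g x) := fun X Y => by
    have hd' : HasFDerivAt (fun y => fderiv ℝ f y X) ((fderiv ℝ (fderiv ℝ f) x).flip X) x := by
      simpa using hd.hasFDerivAt.clm_apply (hasFDerivAt_const X x)
    have := fderiv_mul_eq_zero hd'.differentiableAt (H.minus.differentiableAt hx)
      (H.eventually hx fun y hy => H.fderiv_base_mul hφ hy X) Y
    rw [hd'.fderiv] at this
    exact eq_neg_of_add_eq_zero_left this
  have hsymm := (H.base.contDiffOn.contDiffAt hnhds).isSymmSndFDerivAt (by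
    rw [minSmoothness_of_isRCLikeNormedField]
    exact WithTop.coe_le_coe.2 (le_top : (2 : ℕ∞) ≤ ⊤))
  rw [hkey, hkey, hsymm.eq]

lemma IsTripleLift.fderiv_minus_mul (H : IsTripleLift φ p Ω f g h)
    (hφ : IsTotallyIsotropicImmersion φ) {x : EuclideanSpace ℝ (Fin 2)} (hx : x ∈ Ω)
    (X : EuclideanSpace ℝ (Fin 2)) : mul (fderiv ℝ g x X) (h x) = 0 := by
  have hF := H.base.isoFrame hφ hx
  have hsymm := H.mul_fderiv_symm hφ hx (EuclideanSpace.single 0 1) (EuclideanSpace.single 1 1)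
  have h0 := hF.mul_eq_zero_of_symm (H.mul_frame hφ hx)
    (H.mul_fderiv_minus hφ hx (EuclideanSpace.single 0 1)) hsymm
  -- Exchanging the two partial derivatives in the frame handles the other coordinate direction.
  have h1 := hF.swap.mul_eq_zero_of_symm (fun i => H.mul_frame hφ hx _)
    (H.mul_fderiv_minus hφ hx (EuclideanSpace.single 1 1)) hsymm.symm
  rw [euclidean_eq_add X]
  simp [h0, h1]

lemma IsTripleLift.mul_fderiv_plus (H : IsTripleLift φ p Ω f g h)
    (hφ : IsTotallyIsotropicImmersion φ) {x : EuclideanSpace ℝ (Fin 2)} (hx : x ∈ Ω)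
    (X : EuclideanSpace ℝ (Fin 2)) : mul (g x) (fderiv ℝ h x X) = 0 := by
  have := fderiv_mul_eq_zero (H.minus.differentiableAt hx) (H.plus.differentiableAt hx)
    (H.eventually hx fun y hy => H.mul_eq_zero hφ hy) X
  rwa [H.fderiv_minus_mul hφ hx, add_zero] at this

lemma IsChartLift.tangentMap_mem_map (h : IsChartLift φ p Ω f) (X : TangentSpace (𝓡 2) p)
    (w : (φ p).submodule) {A : Submodule ℝ Zorn}
    (hA : fderiv ℝ f (extChartAt (𝓡 2) p p) X ∈ A) :
    tangentMap φ p X w ∈ A.map (φ p).submodule.mkQ := by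
  obtain ⟨r, rfl⟩ := h.isLocalLift_self.exists_eq_smul w
  rw [map_smul, h.tangentMap_apply X _ rfl]
  exact Submodule.smul_mem _ _ (Submodule.mem_map_of_mem hA)

theorem gauss_isIntegralSurface (hφ : IsTotallyIsotropicImmersion φ) :
    IsIntegralSurface fun p => ![φ p, gaussMinus φ p, gaussPlus φ p] := by
  refine ⟨gauss_mem_incidence hφ, fun i => IsChartLift.isSmooth fun p => ?_, fun p X Y hXY => ?_,
    fun p X => mem_xi_of_forall (gauss_mem_incidence hφ p) fun i w => ?_⟩
  · obtain ⟨Ω, f, g, h, H⟩ := exists_isTripleLift hφ p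
    fin_cases i
    · exact ⟨Ω, f, H.base⟩
    · exact ⟨Ω, g, H.minus⟩
    · exact ⟨Ω, h, H.plus⟩
  · exact hφ.1.2 p (congrFun hXY 0)
  · obtain ⟨Ω, f, g, h, H⟩ := exists_isTripleLift hφ p
    have hx := H.base.mem
    fin_cases i
    · exact H.base.tangentMap_mem_map X w ⟨H.minus.mem_kerR.2 (H.fderiv_base_mul hφ hx X),
        H.plus.mem_kerL.2 (H.mul_fderiv_base hφ hx X)⟩
    · exact H.minus.tangentMap_mem_map X w ⟨H.plus.mem_kerR.2 (H.fderiv_minus_mul hφ hx X),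
        H.base.mem_kerL.2 (H.mul_fderiv_minus hφ hx X)⟩
    · exact H.plus.tangentMap_mem_map X w ⟨H.base.mem_kerR.2 (H.fderiv_plus_mul hφ hx X),
        H.minus.mem_kerL.2 (H.mul_fderiv_plus hφ hx X)⟩

end Triality

/-! ### The correspondence -/

theorem proposition19 {S : Type*} [TopologicalSpace S]
    [ChartedSpace (EuclideanSpace ℝ (Fin 2)) S] [IsManifold (𝓡 2) ∞ S] :
    (∀ φ : S → ℙ ℝ Triality.Zorn, Triality.IsTotallyIsotropicImmersion φ → ∀ p,
      (∃! l, l ∈ Triality.Quadric ∧ Triality.tangentPlane φ p ≤ Triality.kerR l) ∧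
      (∃! l, l ∈ Triality.Quadric ∧ Triality.tangentPlane φ p ≤ Triality.kerL l)) ∧
    Set.BijOn
      (fun (φ : S → ℙ ℝ Triality.Zorn) (p : S) =>
        ![φ p, Triality.gaussMinus φ p, Triality.gaussPlus φ p])
      {φ | Triality.IsTotallyIsotropicImmersion φ}
      {Φ | Triality.IsIntegralSurface Φ ∧ Triality.IsImmersion fun p => Φ p 0} := by
  refine ⟨fun φ hφ p => ⟨Triality.existsUnique_kerR hφ p, Triality.existsUnique_kerL hφ p⟩,
    fun φ hφ => ⟨Triality.gauss_isIntegralSurface hφ, hφ.1⟩, fun φ _ φ' _ h => ?_, ?_⟩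
  · ext p : 1
    exact congrFun (congrFun h p) 0
  · rintro Φ ⟨hΦ, h0⟩
    have hφ := hΦ.isTotallyIsotropicImmersion h0
    refine ⟨fun p => Φ p 0, hφ, ?_⟩
    ext p i : 2
    -- The other two components satisfy the conditions that characterize the Gauss maps.
    have hle := hΦ.tangentPlane_le p
    fin_cases i
    · rfl
    · exact Triality.gaussMinus_eq hφ ((hΦ.1 p).1 1) (hle.trans inf_le_left)
    · exact Triality.gaussPlus_eq hφ ((hΦ.1 p).1 2) (hle.trans inf_le_right)
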